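/- Let $M$ be an oriented matroid on a finite set $E$ with set of covectors $\mathcal{L}\subseteq\{+,-,0\}^E$, let $\underline{M}$ be its underlying matroid (whose flats are the zero sets of the covectors), and let $r$ be its rank. Let $N$ be an oriented matroid on $E\cup\{g\}$, $g\notin E$, with set of covectors $\mathcal{L}_g$, such that deleting $g$ from $N$ gives $M$. Assume that $g$ is neither a loop nor a coloop of $N$, and that $g$ is generic: $g$ is not in the closure, in $N$, of any $A\subseteq E$ with $r(A)<r$. Order sign vectors by $X\le Y$ if every entry of $X$ is $0$ or equal to the corresponding entry of $Y$; a tope is a maximal covector. Let $\mathcal{L}_g^{++}$ be the set of all $X\in\mathcal{L}_g$ with $X_g=+$ such that every nonzero $Y\in\mathcal{L}_g$ with $Y\le X$ has $Y_g=+$. Let $B^{++}\subseteq\{+,-,0\}^E$ be the set of restrictions to $E$ of the maximal elements of $\mathcal{L}_g^{++}$ (the bounded topes of $M$ with respect to $g$). For a weight $\omega\in\mathbb{R}^E$ let $\emptyset=F_0\subset F_1\subset\dots\subset F_{k+1}=E$ be the flag of sublevel sets of $\omega$, so that $\omega$ is constant on each $F_i\setminus F_{i-1}$ and increases with $i$.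 Let $\underline{M}_\omega$ be the matroid whose bases are the bases of $\underline{M}$ of minimum $\omega$-weight, and let $M_\omega=\bigoplus_{i}(M|F_i)/F_{i-1}$, an orientation of $\underline{M}_\omega$. On the sphere $S=\{\omega\in\mathbb{R}^E:\sum_e\omega_e=0,\ \sum_e\omega_e^2=1\}$ define the Bergman complex $\mathcal{B}(\underline{M})=\{\omega\in S:\underline{M}_\omega\text{ has no loops}\}$ and the positive Bergman complex $\mathcal{B}^+(M)=\{\omega\in S: M_\omega\text{ is acyclic}\}$, where acyclic means that the all-positive sign vector is a covector. For a tope $T$ of $M$ let ${}_TM$ be the reorientation of $M$ obtained by reversing the signs of the elements $e$ with $T_e=-$. Finally let $\mu(M)$ be the value $\mu(\hat 0,\hat 1)$ of the Möbius function of the lattice of flats of $\underline{M}$. Then every element of $B^{++}$ is a tope of $M$, the number of elements of $B^{++}$ is exactly $|\mu(M)|$, and the corresponding positive Bergman complexes cover the Bergman complex: $$\bigcup_{T\in B^{++}}\mathcal{B}^+({}_TM)=\mathcal{B}(\underline{M}).$$ -/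

import Mathlib

/-- The composition `X ∘ Y` of two sign vectors: `X` where `X` is nonzero, `Y` elsewhere. -/
def signComp {E : Type*} (X Y : E → SignType) : E → SignType :=
  fun e => if X e = 0 then Y e else X e

/-- `e` separates `X` and `Y`: the two signs at `e` are nonzero and opposite. -/
def SignSep {E : Type*} (X Y : E → SignType) (e : E) : Prop :=
  X e ≠ 0 ∧ X e = -Y e

/-- The face order on sign vectors: `X` arises from `Y` by replacing some entries by `0`.
(This is not the pointwise order induced by `-1 < 0 < 1`.) -/
def SignFace {E : Type*} (X Y : E → SignType) : Prop :=
  ∀ e, X e = 0 ∨ X e = Y e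

/-- Oriented matroids on the ground set `E`, presented by the covector axioms. -/
structure OrientedMatroid (E : Type*) where
  covectors : Set (E → SignType)
  zero_mem : 0 ∈ covectors
  neg_mem : ∀ X ∈ covectors, -X ∈ covectors
  comp_mem : ∀ X ∈ covectors, ∀ Y ∈ covectors, signComp X Y ∈ covectors
  elim : ∀ X ∈ covectors, ∀ Y ∈ covectors, ∀ e, SignSep X Y e →
    ∃ Z ∈ covectors, Z e = 0 ∧ ∀ f, ¬ SignSep X Y f → Z f = signComp X Y f

namespace OrientedMatroid

variable {E : Type*}

/-- A set meets the support of every nonzero covector. -/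
def Transversal (M : OrientedMatroid E) (B : Set E) : Prop :=
  ∀ X ∈ M.covectors, (∀ e ∈ B, X e = 0) → X = 0

lemma exists_elim (M : OrientedMatroid E) {X Y : E → SignType} (hX : X ∈ M.covectors)
    (hY : Y ∈ M.covectors) {e : E} (hXe : X e ≠ 0) (hYe : Y e ≠ 0) :
    ∃ Z ∈ M.covectors, Z e = 0 ∧ ∀ f, (X f = 0 ∨ Y f = 0) → (Z f = 0 ↔ X f = 0 ∧ Y f = 0) := by
  have key : ∀ Y ∈ M.covectors, X e = - Y e →
      ∃ Z ∈ M.covectors, Z e = 0 ∧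
        ∀ f, (X f = 0 ∨ Y f = 0) → (Z f = 0 ↔ X f = 0 ∧ Y f = 0) := by
    intro Y hY h
    obtain ⟨Z, hZ, hZe, hZf⟩ := M.elim X hX Y hY e ⟨hXe, h⟩
    refine ⟨Z, hZ, hZe, fun f hf => ?_⟩
    have hns : ¬ SignSep X Y f := by
      rintro ⟨h1, h2⟩
      rcases hf with hf | hf
      · exact h1 hf
      · rw [hf] at h2
        exact h1 (by simpa using h2)
    rw [hZf f hns]
    unfold signComp
    split_ifs with h0 <;> simp [h0]
  by_cases h : X e = - Y e
  · exact key Y hY h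
  · obtain ⟨Z, hZ, hZe, hZf⟩ := key (-Y) (M.neg_mem Y hY) (by
      simp only [Pi.neg_apply, neg_neg]
      revert hXe hYe h
      generalize X e = a
      generalize Y e = b
      revert a b
      decide)
    refine ⟨Z, hZ, hZe, fun f hf => ?_⟩
    have := hZf f (by simpa using hf)
    simpa using this

lemma minimal_transversal_iff (M : OrientedMatroid E) (B : Set E) :
    Minimal M.Transversal B ↔ M.Transversal B ∧
      ∀ e ∈ B, ∃ X ∈ M.covectors, X e ≠ 0 ∧ ∀ f ∈ B, f ≠ e → X f = 0 := by
  constructor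
  · intro h
    refine ⟨h.prop, fun e he => ?_⟩
    by_contra! hc
    have : M.Transversal (B \ {e}) := by
      intro X hX h0
      refine h.prop X hX fun f hf => ?_
      by_cases hfe : f = e
      · by_contra h1
        subst hfe
        obtain ⟨f', hf', hne, h2⟩ := hc X hX h1
        exact h2 (h0 f' ⟨hf', hne⟩)
      · exact h0 f ⟨hf, hfe⟩
    exact (h.le_of_le this Set.sdiff_subset he).2 rfl
  · rintro ⟨hB, h⟩
    refine ⟨hB, fun C hC hCB e he => ?_⟩
    by_contra heC
    obtain ⟨X, hX, hXe, hX0⟩ := h e he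
    exact hXe (congrFun (hC X hX fun f hf => hX0 f (hCB hf) (by rintro rfl; exact heC hf)) e)

lemma exists_minimal_transversal [Finite E] (M : OrientedMatroid E) :
    ∃ B, Minimal M.Transversal B := by
  have h : M.Transversal Set.univ := fun X _ h => funext fun e => h e trivial
  obtain ⟨B, -, hB⟩ := (Set.toFinite {B | M.Transversal B}).exists_le_minimal h
  exact ⟨B, hB⟩

lemma exchange (M : OrientedMatroid E) : Matroid.ExchangeProperty (Minimal M.Transversal) := by
  intro B C hB hC e he
  rw [minimal_transversal_iff] at hB hC
  obtain ⟨X, hX, hXe, hX0⟩ := hB.2 e he.1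
  have : ∃ f ∈ C, X f ≠ 0 := by
    by_contra! h
    exact hXe (congrFun (hC.1 X hX h) e)
  obtain ⟨f, hfC, hXf⟩ := this
  have hfe : f ≠ e := by rintro rfl; exact he.2 hfC
  have hfB : f ∉ B := fun hfB => hXf (hX0 f hfB hfe)
  refine ⟨f, ⟨hfC, hfB⟩, (M.minimal_transversal_iff _).2 ⟨?_, ?_⟩⟩
  · intro Y hY hY0
    by_cases hYe : Y e = 0
    · refine hB.1 Y hY fun b hb => ?_
      by_cases hbe : b = e
      · rw [hbe, hYe]
      · exact hY0 b (Or.inr ⟨hb, hbe⟩)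
    · exfalso
      obtain ⟨Z, hZ, hZe, hZf⟩ := M.exists_elim hX hY hXe hYe
      have hZ0 : Z = 0 := by
        refine hB.1 Z hZ fun b hb => ?_
        by_cases hbe : b = e
        · rw [hbe, hZe]
        · exact (hZf b (Or.inl (hX0 b hb hbe))).2 ⟨hX0 b hb hbe, hY0 b (Or.inr ⟨hb, hbe⟩)⟩
      exact hXf ((hZf f (Or.inr (hY0 f (Or.inl rfl)))).1 (congrFun hZ0 f)).1
  · rintro b (rfl | ⟨hb, hbe⟩)
    · refine ⟨X, hX, hXf, ?_⟩
      rintro c (rfl | ⟨hc, hce⟩) hcb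
      · exact absurd rfl hcb
      · exact hX0 c hc hce
    · have hbe : b ≠ e := hbe
      obtain ⟨Y, hY, hYb, hY0⟩ := hB.2 b hb
      by_cases hYf : Y f = 0
      · refine ⟨Y, hY, hYb, ?_⟩
        rintro c (rfl | ⟨hc, hce⟩) hcb
        · exact hYf
        · exact hY0 c hc hcb
      · obtain ⟨Z, hZ, hZf, hZ0⟩ := M.exists_elim hX hY hXf hYf
        have hXb := hX0 b hb hbe
        refine ⟨Z, hZ, fun h => hYb ((hZ0 b (Or.inl hXb)).1 h).2, ?_⟩
        rintro c (rfl | ⟨hc, hce⟩) hcb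
        · exact hZf
        · exact (hZ0 c (Or.inl (hX0 c hc hce))).2 ⟨hX0 c hc hce, hY0 c hc hcb⟩

/-- The underlying matroid: its bases are the minimal sets meeting the support of every nonzero
covector. Its flats are the zero sets of the covectors, see `isFlat_matroid_iff`. -/
def matroid [Finite E] (M : OrientedMatroid E) : Matroid E :=
  Matroid.ofIsBaseOfFinite Set.finite_univ (Minimal M.Transversal)
    M.exists_minimal_transversal M.exchange fun _ _ => Set.subset_univ _

lemma indep_insert_aux (M : OrientedMatroid E) {I : Set E}
    (hI : ∀ e ∈ I, ∃ X ∈ M.covectors, X e ≠ 0 ∧ ∀ f ∈ I, f ≠ e → X f = 0) {X : E → SignType}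
    (hX : X ∈ M.covectors) (hXI : ∀ f ∈ I, X f = 0) {e : E} (hXe : X e ≠ 0) :
    ∀ b ∈ insert e I, ∃ Y ∈ M.covectors, Y b ≠ 0 ∧ ∀ f ∈ insert e I, f ≠ b → Y f = 0 := by
  rintro b (rfl | hb)
  · refine ⟨X, hX, hXe, ?_⟩
    rintro c (rfl | hc) hcb
    · exact absurd rfl hcb
    · exact hXI c hc
  · obtain ⟨Y, hY, hYb, hY0⟩ := hI b hb
    by_cases hYe : Y e = 0
    · refine ⟨Y, hY, hYb, ?_⟩
      rintro c (rfl | hc) hcb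
      · exact hYe
      · exact hY0 c hc hcb
    · obtain ⟨Z, hZ, hZe, hZ0⟩ := M.exists_elim hX hY hXe hYe
      refine ⟨Z, hZ, fun h => hYb ((hZ0 b (Or.inl (hXI b hb))).1 h).2, ?_⟩
      rintro c (rfl | hc) hcb
      · exact hZe
      · exact (hZ0 c (Or.inl (hXI c hc))).2 ⟨hXI c hc, hY0 c hc hcb⟩

lemma indep_matroid_iff [Finite E] (M : OrientedMatroid E) (I : Set E) :
    M.matroid.Indep I ↔ ∀ e ∈ I, ∃ X ∈ M.covectors, X e ≠ 0 ∧ ∀ f ∈ I, f ≠ e → X f = 0 := by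
  constructor
  · intro hI e he
    obtain ⟨B, hB, hIB⟩ := hI.exists_isBase_superset
    obtain ⟨X, hX, hXe, hX0⟩ := ((M.minimal_transversal_iff B).1 hB).2 e (hIB he)
    exact ⟨X, hX, hXe, fun f hf => hX0 f (hIB hf)⟩
  · intro hI
    obtain ⟨J, hIJ, hJ⟩ := (Set.toFinite {I : Set E | ∀ e ∈ I, ∃ X ∈ M.covectors,
      X e ≠ 0 ∧ ∀ f ∈ I, f ≠ e → X f = 0}).exists_le_maximal hI
    have hB : M.matroid.IsBase J := (M.minimal_transversal_iff J).2 ⟨fun X hX hX0 => by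
      by_contra hne
      obtain ⟨e, he⟩ := Function.ne_iff.1 hne
      exact he (hX0 e (hJ.le_of_ge (M.indep_insert_aux hJ.prop hX hX0 he)
        (Set.subset_insert e J) (Set.mem_insert e J))), hJ.prop⟩
    exact hB.indep.subset hIJ

lemma mem_closure_matroid_iff [Finite E] (M : OrientedMatroid E) (A : Set E) (e : E) :
    e ∈ M.matroid.closure A ↔ ∀ X ∈ M.covectors, (∀ a ∈ A, X a = 0) → X e = 0 := by
  obtain ⟨I, hI⟩ := M.matroid.exists_isBasis A (Set.subset_univ A)
  have hIi := (M.indep_matroid_iff I).1 hI.indep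
  rw [← hI.closure_eq_closure, hI.indep.mem_closure_iff']
  constructor
  · rintro ⟨-, h⟩ X hX hXA
    by_contra hXe
    have heI := h ((M.indep_matroid_iff _).2
      (M.indep_insert_aux hIi hX (fun f hf => hXA f (hI.subset hf)) hXe))
    exact hXe (hXA e (hI.subset heI))
  · intro h
    refine ⟨Set.mem_univ e, fun hins => ?_⟩
    by_contra heI
    obtain ⟨X, hX, hXe, hX0⟩ := (M.indep_matroid_iff _).1 hins e (Set.mem_insert e I)
    have hXI : ∀ f ∈ I, X f = 0 := fun f hf =>
      hX0 f (Set.mem_insert_of_mem e hf) (by rintro rfl; exact heI hf)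
    refine hXe (h X hX fun a ha => ?_)
    by_contra hXa
    exact hXa (hXI a (hI.mem_of_insert_indep ha
      ((M.indep_matroid_iff _).2 (M.indep_insert_aux hIi hX hXI hXa))))

lemma isFlat_matroid_iff [Finite E] (M : OrientedMatroid E) (F : Set E) :
    M.matroid.IsFlat F ↔ ∃ X ∈ M.covectors, F = {e | X e = 0} := by
  rw [Matroid.isFlat_iff_closure_eq]
  constructor
  · intro hF
    obtain ⟨Z, -, hZ⟩ := (Set.toFinite {Z : Set E | ∃ X ∈ M.covectors,
      (∀ e ∈ F, X e = 0) ∧ Z = {e | X e = 0}}).exists_le_minimal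
      ⟨0, M.zero_mem, fun _ _ => rfl, rfl⟩
    obtain ⟨X, hX, hXF, rfl⟩ := hZ.prop
    refine ⟨X, hX, Set.Subset.antisymm hXF fun e he => ?_⟩
    rw [← hF, mem_closure_matroid_iff]
    intro Y hY hYF
    have := hZ.le_of_le (y := {e | signComp X Y e = 0})
      ⟨signComp X Y, M.comp_mem X hX Y hY, fun f hf => by simp [signComp, hXF f hf, hYF f hf], rfl⟩
      (fun f hf => by
        by_contra h
        exact h (by simpa [signComp, show X f ≠ 0 from h] using hf))
    have h1 : signComp X Y e = 0 := this he
    have h2 : X e = 0 := he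
    simpa [signComp, h2] using h1
  · rintro ⟨X, hX, rfl⟩
    refine Set.Subset.antisymm (fun e he => ?_) (M.matroid.subset_closure _ (Set.subset_univ _))
    exact (M.mem_closure_matroid_iff _ e).1 he X hX fun a ha => ha

/-- A tope is a maximal covector. -/
def IsTope (M : OrientedMatroid E) (T : E → SignType) : Prop :=
  T ∈ M.covectors ∧ ∀ Y ∈ M.covectors, SignFace T Y → Y = T

/-- An oriented matroid is acyclic if the all-positive sign vector is a covector. -/
def IsAcyclic (M : OrientedMatroid E) : Prop :=
  (fun _ => 1) ∈ M.covectors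

open Classical in
/-- Flip the signs of `X` on `A`. -/
noncomputable def signFlip (A : Set E) (X : E → SignType) : E → SignType :=
  fun e => if e ∈ A then - X e else X e

lemma signFlip_signFlip (A : Set E) (X : E → SignType) : signFlip A (signFlip A X) = X := by
  funext e
  unfold signFlip
  split_ifs <;> simp

/-- The reorientation of `M` on `A`: the signs of all covectors are flipped on `A`. -/
def reorient (M : OrientedMatroid E) (A : Set E) : OrientedMatroid E where
  covectors := {X | signFlip A X ∈ M.covectors}
  zero_mem := by
    have : signFlip A (0 : E → SignType) = 0 := by funext e; simp [signFlip]
    simpa [this] using M.zero_mem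
  neg_mem X hX := by
    have : signFlip A (-X) = - signFlip A X := by funext e; by_cases h : e ∈ A <;> simp [signFlip, h]
    simpa [this] using M.neg_mem _ hX
  comp_mem X hX Y hY := by
    have : signFlip A (signComp X Y) = signComp (signFlip A X) (signFlip A Y) := by
      funext e; by_cases h : e ∈ A <;> by_cases h' : X e = 0 <;> simp [signFlip, signComp, h, h']
    simpa [this] using M.comp_mem _ hX _ hY
  elim X hX Y hY e he := by
    have hsep : ∀ f, SignSep (signFlip A X) (signFlip A Y) f ↔ SignSep X Y f := by
      intro f
      by_cases h : f ∈ A <;> simp [SignSep, signFlip, h, neg_eq_iff_eq_neg]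
    obtain ⟨Z, hZ, hZe, hZf⟩ := M.elim _ hX _ hY e ((hsep e).2 he)
    refine ⟨signFlip A Z, by simpa [signFlip_signFlip] using hZ, by simp [signFlip, hZe], ?_⟩
    intro f hf
    have := hZf f (mt (hsep f).1 hf)
    by_cases h : f ∈ A <;> by_cases h' : X f = 0 <;> simp_all [signFlip, signComp]

/-- The initial oriented matroid `M_ω`, that is the direct sum `⨁ (M | F_i) / F_{i-1}` over the
flag `F_0 ⊂ F_1 ⊂ ⋯` of lower level sets of the weight `ω`. The summand at the level `ω = c` has
the covectors `X` restricted to `{ω = c}`, where `X` is a covector of `M` that vanishes on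
`{ω < c}`; a covector of the direct sum is any concatenation of covectors of the summands.
(A real `c` that is not a value of `ω` imposes no condition.) -/
def initial (M : OrientedMatroid E) (ω : E → ℝ) : OrientedMatroid E where
  covectors := {V | ∀ c : ℝ, ∃ X ∈ M.covectors,
    (∀ e, ω e < c → X e = 0) ∧ ∀ e, ω e = c → V e = X e}
  zero_mem c := ⟨0, M.zero_mem, fun _ _ => rfl, fun _ _ => rfl⟩
  neg_mem V hV c := by
    obtain ⟨X, hX, h1, h2⟩ := hV c
    exact ⟨-X, M.neg_mem X hX, fun e he => by simp [h1 e he], fun e he => by simp [h2 e he]⟩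
  comp_mem V hV W hW c := by
    obtain ⟨X, hX, h1, h2⟩ := hV c
    obtain ⟨Y, hY, h3, h4⟩ := hW c
    exact ⟨signComp X Y, M.comp_mem X hX Y hY, fun e he => by simp [signComp, h1 e he, h3 e he],
      fun e he => by simp [signComp, h2 e he, h4 e he]⟩
  elim V hV W hW e he := by
    classical
    obtain ⟨X, hX, h1, h2⟩ := hV (ω e)
    obtain ⟨Y, hY, h3, h4⟩ := hW (ω e)
    have hsep : ∀ f, ω f = ω e → (SignSep X Y f ↔ SignSep V W f) := fun f hf => by
      simp [SignSep, h2 f hf, h4 f hf]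
    obtain ⟨Z, hZ, hZe, hZf⟩ := M.elim X hX Y hY e ((hsep e rfl).2 he)
    refine ⟨fun f => if ω f = ω e then Z f else signComp V W f, ?_, by simpa using hZe, ?_⟩
    · intro c
      by_cases hc : c = ω e
      · subst hc
        refine ⟨Z, hZ, fun f hf => ?_, fun f hf => by simp [hf]⟩
        rw [hZf f (by simp [SignSep, h1 f hf])]
        simp [signComp, h1 f hf, h3 f hf]
      · obtain ⟨X', hX', h1', h2'⟩ := hV c
        obtain ⟨Y', hY', h3', h4'⟩ := hW c
        refine ⟨signComp X' Y', M.comp_mem X' hX' Y' hY',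
          fun f hf => by simp [signComp, h1' f hf, h3' f hf], fun f hf => ?_⟩
        have : ω f ≠ ω e := by rw [hf]; exact hc
        simp [this, signComp, h2' f hf, h4' f hf]
    · intro f hf
      by_cases h : ω f = ω e
      · simp only [h, if_true]
        rw [hZf f (mt (hsep f h).1 hf)]
        simp [signComp, h2 f h, h4 f h]
      · simp [h]

/-- The bounded complex of the affine oriented matroid `(N, g)`: the covectors `X` with `X g = +`
all of whose nonzero faces `Y` satisfy `Y g = +`. -/
def boundedComplex (N : OrientedMatroid E) (g : E) : Set (E → SignType) :=
  {X | X ∈ N.covectors ∧ X g = 1 ∧ ∀ Y ∈ N.covectors, SignFace Y X → Y = 0 ∨ Y g = 1}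

/-- The bounded topes of `N` with respect to `g`: the maximal elements of the bounded complex. -/
def boundedTopes (N : OrientedMatroid E) (g : E) : Set (E → SignType) :=
  {X | X ∈ N.boundedComplex g ∧ ∀ Y ∈ N.boundedComplex g, SignFace X Y → Y = X}

/-- `N`, on the ground set `E ∪ {g}` with `g = none`, is an extension of `M` by a generic element:
the deletion of `g` from `N` is `M`, the element `g` is neither a loop nor a coloop of `N`, and
`g` is not in the closure of any subset of `E` of rank less than the rank of `M`. -/
structure IsGenericExtension [Finite E] (M : OrientedMatroid E)
    (N : OrientedMatroid (Option E)) : Prop where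
  deletion : M.covectors = (fun X e => X (some e)) '' N.covectors
  not_isLoop : ¬ N.matroid.IsLoop none
  not_isColoop : ¬ N.matroid.IsColoop none
  generic : ∀ A : Set E, M.matroid.eRk A < M.matroid.eRank →
    none ∉ N.matroid.closure (some '' A)

/-- The sign vectors on `E` obtained from the bounded topes of an extension `N` with respect to
`g = none` by deleting `g`. -/
def boundedTopesDelete (N : OrientedMatroid (Option E)) : Set (E → SignType) :=
  (fun X e => X (some e)) '' N.boundedTopes none

end OrientedMatroid

/-- The sphere of weights with coordinate sum zero and Euclidean norm one. -/
def weightSphere (E : Type*) [Fintype E] : Set (E → ℝ) :=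
  {ω | ∑ e, ω e = 0 ∧ ∑ e, ω e ^ 2 = 1}

open Classical in
/-- The weight of a set of elements. -/
noncomputable def setWeight {E : Type*} [Fintype E] (ω : E → ℝ) (B : Set E) : ℝ :=
  ∑ e ∈ B.toFinset, ω e

/-- `B` is a basis of `U` of minimum `ω`-weight, that is a basis of the matroid `U_ω`. -/
def Matroid.IsMinWeightBase {E : Type*} [Fintype E] (U : Matroid E) (ω : E → ℝ) (B : Set E) :
    Prop :=
  U.IsBase B ∧ ∀ C, U.IsBase C → setWeight ω B ≤ setWeight ω C

/-- The Bergman complex of a matroid on the ground set `E`: the weights `ω` on the sphere such that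
`U_ω` has no loops, that is every element lies in some basis of minimum weight. -/
def Matroid.bergman {E : Type*} [Fintype E] (U : Matroid E) : Set (E → ℝ) :=
  {ω | ω ∈ weightSphere E ∧ ∀ e, ∃ B, U.IsMinWeightBase ω B ∧ e ∈ B}

/-- The positive Bergman complex: the weights `ω` on the sphere such that `M_ω` is acyclic. -/
def OrientedMatroid.positiveBergman {E : Type*} [Fintype E] (M : OrientedMatroid E) :
    Set (E → ℝ) :=
  {ω | ω ∈ weightSphere E ∧ (M.initial ω).IsAcyclic}

open Classical in
/-- The Möbius number `μ(U) = μ(0̂, 1̂)` of the lattice of flats of a matroid on a finite set. -/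
noncomputable def Matroid.mobiusNumber {E : Type*} [Fintype E] (U : Matroid E) : ℤ :=
  letI : LocallyFiniteOrder {F : Set E // U.IsFlat F} := Fintype.toLocallyFiniteOrder
  IncidenceAlgebra.mu ℤ (⟨U.closure ∅, U.isFlat_closure ∅⟩ : {F : Set E // U.IsFlat F})
    ⟨U.E, U.ground_isFlat⟩

/-!
Write `X ∘ Q` for `signComp X Q`. If `X` is a bounded covector and `Q` is a cocircuit of the
restriction to the zero set of `X`, then genericity of `g` makes `X ∘ Q` or `X ∘ (-Q)` bounded.
Hence a bounded covector can be enlarged to one with any prescribed smaller flat as its zero set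
and, going down a flag of flats, there is a bounded covector whose faces have all these flats as
their zero sets. For the flag of sublevel sets of a weight in the Bergman complex this is a bounded
tope whose positive Bergman complex contains the weight.

The alternating sum of the bounded covectors by the rank of their zero sets is, up to sign, the
Euler characteristic of the bounded complex. It is unchanged when an element `e` is deleted, since
the bounded covectors whose image in the deletion is not bounded cancel in pairs. When `e` is a
coloop of the deletion of `g`, the bounded complex is a pyramid instead, and all terms but the apex
cancel. So the sum is `±1`, with a sign that depends only on the rank. Contracting a proper flat `F`
preserves genericity, so the bounded covectors that vanish on `F` have this same sum for every `F`,
and Möbius inversion gives `±μ(M)` for those that vanish only on the loops: the bounded topes.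
-/

section SignVectors

variable {α : Type*} {A : Set α} {X Y Z : α → SignType} {e : α}

lemma signType_eq_or_eq_neg {a b : SignType} (ha : a ≠ 0) (hb : b ≠ 0) : a = b ∨ a = -b := by
  revert a b; decide

lemma signComp_eq_zero : signComp X Y e = 0 ↔ X e = 0 ∧ Y e = 0 := by
  by_cases h : X e = 0 <;> simp [signComp, h]

lemma signFace_signComp (X Y : α → SignType) : SignFace X (signComp X Y) := fun e => by
  by_cases h : X e = 0 <;> simp [signComp, h]

lemma SignFace.trans (hXY : SignFace X Y) (hYZ : SignFace Y Z) : SignFace X Z := fun e =>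
  (hXY e).elim Or.inl fun h => h ▸ hYZ e

lemma SignFace.eq_zero (hXY : SignFace X Y) (he : Y e = 0) : X e = 0 :=
  (hXY e).elim id fun h => h.trans he

/-- The face order tested on the elements of `A` only. -/
def SignFaceOn (A : Set α) (X Y : α → SignType) : Prop :=
  ∀ e ∈ A, X e = 0 ∨ X e = Y e

lemma SignFaceOn.signComp (hX : SignFaceOn A X Z) (hY : SignFaceOn A Y Z) :
    SignFaceOn A (signComp X Y) Z := fun e he => by
  by_cases h : X e = 0
  · simpa [_root_.signComp, h] using hY e he
  · simpa [_root_.signComp, h] using hX e he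

end SignVectors

namespace OrientedMatroid

variable {α : Type*} {N : OrientedMatroid α} {g : α} {X : α → SignType}

lemma exists_elim_signFaceOn {Y Z : α → SignType} {A : Set α} {e : α}
    (hY : Y ∈ N.covectors) (hZ : Z ∈ N.covectors) (he : SignSep Y Z e)
    (hYX : SignFaceOn A Y X) (hZX : SignFaceOn A Z X) :
    ∃ W ∈ N.covectors, W e = 0 ∧ (∀ f ∈ A, W f = signComp Y Z f) ∧
      ∀ f, Y f = 0 → Z f = 0 → W f = 0 := by
  obtain ⟨W, hW, hWe, hWf⟩ := N.elim Y hY Z hZ e he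
  refine ⟨W, hW, hWe, fun f hf => hWf f ?_, fun f hYf hZf => ?_⟩
  · rintro ⟨hYf, hYZ⟩
    have hZf : Z f ≠ 0 := fun h => hYf (by simpa [h] using hYZ)
    rw [(hYX f hf).resolve_left hYf, (hZX f hf).resolve_left hZf] at hYZ
    exact hYf ((hYX f hf).elim id fun h => h.trans (SignType.self_eq_neg_iff.1 hYZ))
  · rw [hWf f fun h => h.1 hYf]
    exact signComp_eq_zero.2 ⟨hYf, hZf⟩

/-- `e` lies in the closure of `A`, expressed by covectors; see `mem_closure_matroid_iff`. -/
def Spans (N : OrientedMatroid α) (A : Set α) (e : α) : Prop :=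
  ∀ X ∈ N.covectors, (∀ a ∈ A, X a = 0) → X e = 0

lemma not_spans_iff {A : Set α} {e : α} :
    ¬ N.Spans A e ↔ ∃ X ∈ N.covectors, (∀ a ∈ A, X a = 0) ∧ X e ≠ 0 := by
  simp only [Spans, not_forall, exists_prop]

lemma spans_empty_iff {e : α} : N.Spans ∅ e ↔ ∀ X ∈ N.covectors, X e = 0 := by
  simp [Spans]

lemma exists_eq_zero_iff_spans_empty [Finite α] (N : OrientedMatroid α) :
    ∃ P ∈ N.covectors, ∀ e, P e = 0 ↔ N.Spans ∅ e := by
  obtain ⟨Z, -, hZ⟩ := (Set.toFinite {Z : Set α | ∃ X ∈ N.covectors,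
    Z = {f | X f = 0}}).exists_le_minimal ⟨0, N.zero_mem, rfl⟩
  obtain ⟨P, hP, rfl⟩ := hZ.prop
  refine ⟨P, hP, fun e => ⟨fun he => spans_empty_iff.2 fun X hX => ?_,
    fun he => spans_empty_iff.1 he P hP⟩⟩
  exact (signComp_eq_zero.1 (hZ.le_of_le ⟨_, N.comp_mem P hP X hX, rfl⟩
    (fun f hf => (signComp_eq_zero.1 hf).1) he)).2

lemma isTope_of_spans_empty (hX : X ∈ N.covectors) (hX0 : ∀ e, X e = 0 → N.Spans ∅ e) :
    N.IsTope X :=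
  ⟨hX, fun Y hY hXY => funext fun e => (hXY e).elim
    (fun h => by rw [h, spans_empty_iff.1 (hX0 e h) Y hY]) Eq.symm⟩

/-- The element `g` is in general position: it is neither a loop nor a coloop, and it lies in the
closure of a set of other elements only if that set is spanning. -/
structure IsGenericElement (N : OrientedMatroid α) (g : α) : Prop where
  not_isLoop : ¬ N.Spans ∅ g
  not_isColoop : N.Spans {g}ᶜ g
  transversal_of_spans : ∀ A : Set α, g ∉ A → N.Spans A g → N.Transversal A

namespace IsGenericElement

lemma transversal_compl (hg : N.IsGenericElement g) : N.Transversal {g}ᶜ :=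
  hg.transversal_of_spans _ (by simp) hg.not_isColoop

lemma exists_eq_zero_and_ne_zero (hg : N.IsGenericElement g) {Y : α → SignType}
    (hY : Y ∈ N.covectors) (hY0 : Y ≠ 0) (hYg : Y g = 0) :
    ∃ U ∈ N.covectors, U ≠ 0 ∧ (∀ f ≠ g, Y f = 0 → U f = 0) ∧ ∃ a ≠ g, Y a ≠ 0 ∧ U a = 0 := by
  have hspan : ¬ N.Spans {f | f ≠ g ∧ Y f = 0} g := fun h =>
    hY0 (hg.transversal_of_spans _ (fun h => h.1 rfl) h Y hY fun a ha => ha.2)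
  obtain ⟨V, hV, hVY, hVg⟩ := not_spans_iff.1 hspan
  obtain ⟨a, hag, hVa⟩ : ∃ a ≠ g, V a ≠ 0 := by
    by_contra! h
    exact hVg (congrFun (hg.transversal_compl V hV h) g)
  have hYa : Y a ≠ 0 := fun h => hVa (hVY a ⟨hag, h⟩)
  obtain ⟨U, hU, hUa, hUf⟩ := N.exists_elim hV hY hVa hYa
  refine ⟨U, hU, fun h => ?_, fun f hfg hf => ?_, a, hag, hYa, hUa⟩
  · exact hVg ((hUf g (Or.inr hYg)).1 (congrFun h g)).1
  · exact (hUf f (Or.inr hf)).2 ⟨hVY f ⟨hfg, hf⟩, hf⟩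

end IsGenericElement

lemma mem_boundedComplex_of_signFace {Y : α → SignType} (hY : Y ∈ N.boundedComplex g)
    (hX : X ∈ N.covectors) (hXY : SignFace X Y) (hX0 : X ≠ 0) : X ∈ N.boundedComplex g :=
  ⟨hX, (hY.2.2 X hX hXY).resolve_left hX0, fun Z hZ hZX => hY.2.2 Z hZ (hZX.trans hXY)⟩

lemma eq_zero_of_mem_boundedComplex {Y : α → SignType} (hX : X ∈ N.boundedComplex g)
    (hY : Y ∈ N.covectors) (hYX : SignFace Y X) (hYg : Y g = 0) : Y = 0 :=
  (hX.2.2 Y hY hYX).resolve_right (by simp [hYg])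

lemma exists_signFace_of_notMem_boundedComplex (hX : X ∈ N.covectors) (hXg : X g = 1)
    (h : X ∉ N.boundedComplex g) : ∃ Y ∈ N.covectors, SignFace Y X ∧ Y ≠ 0 ∧ Y g = 0 := by
  obtain ⟨Y, hY, hYX, hY0, hYg⟩ : ∃ Y ∈ N.covectors, SignFace Y X ∧ Y ≠ 0 ∧ Y g ≠ 1 := by
    by_contra! hc
    exact h ⟨hX, hXg, fun Y hY hYX => or_iff_not_imp_left.2 (hc Y hY hYX)⟩
  exact ⟨Y, hY, hYX, hY0, (hYX g).resolve_right (hXg ▸ hYg)⟩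

/-- `Q` restricts to a cocircuit of the restriction of `N` to `A`: the support of `Q` in `A` is
nonempty, and minimal among the nonempty supports of covectors in `A`. -/
structure IsCocircuitOn (N : OrientedMatroid α) (A : Set α) (Q : α → SignType) : Prop where
  mem_covectors : Q ∈ N.covectors
  exists_ne_zero : ∃ e ∈ A, Q e ≠ 0
  eq_zero_of_exists : ∀ V ∈ N.covectors, (∀ f ∈ A, Q f = 0 → V f = 0) →
    (∃ e ∈ A, Q e ≠ 0 ∧ V e = 0) → ∀ f ∈ A, V f = 0

lemma IsCocircuitOn.neg {A : Set α} {Q : α → SignType} (hQ : N.IsCocircuitOn A Q) :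
    N.IsCocircuitOn A (-Q) where
  mem_covectors := N.neg_mem Q hQ.mem_covectors
  exists_ne_zero := by simpa using hQ.exists_ne_zero
  eq_zero_of_exists := by simpa using hQ.eq_zero_of_exists

lemma exists_isCocircuitOn [Finite α] {A : Set α} {P : α → SignType} (hP : P ∈ N.covectors)
    (hPA : ∃ e ∈ A, P e ≠ 0) : ∃ Q, N.IsCocircuitOn A Q ∧ ∀ f ∈ A, P f = 0 → Q f = 0 := by
  obtain ⟨Z, hPZ, hZ⟩ := (Set.toFinite {Z : Set α | ∃ Q ∈ N.covectors,
    (∃ e ∈ A, Q e ≠ 0) ∧ Z = {f | f ∈ A ∧ Q f = 0}}).exists_le_maximal ⟨P, hP, hPA, rfl⟩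
  obtain ⟨Q, hQ, hQA, rfl⟩ := hZ.prop
  refine ⟨Q, ⟨hQ, hQA, ?_⟩, fun f hfA hf => (hPZ ⟨hfA, hf⟩).2⟩
  rintro V hV hQV ⟨e, heA, hQe, hVe⟩
  by_contra! hVA
  exact hQe (hZ.le_of_ge ⟨V, hV, hVA, rfl⟩ (fun f hf => ⟨hf.1, hQV f hf.1 hf.2⟩) ⟨heA, hVe⟩).2

namespace IsGenericElement

lemma apply_ne_zero_of_isCocircuitOn (hg : N.IsGenericElement g) {Q V : α → SignType}
    (hQ : N.IsCocircuitOn {g}ᶜ Q) (hV : V ∈ N.covectors) (hV0 : V ≠ 0)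
    (hQV : ∀ f ≠ g, Q f = 0 → V f = 0) : V g ≠ 0 := by
  intro hVg
  obtain ⟨U, hU, hU0, hVU, a, hag, hVa, hUa⟩ := hg.exists_eq_zero_and_ne_zero hV hV0 hVg
  refine hU0 (hg.transversal_compl U hU ?_)
  exact hQ.eq_zero_of_exists U hU (fun f hf h => hVU f hf (hQV f hf h))
    ⟨a, hag, fun h => hVa (hQV a hag h), hUa⟩

lemma mem_boundedComplex_of_isCocircuitOn (hg : N.IsGenericElement g) {Q : α → SignType}
    (hQ : N.IsCocircuitOn {g}ᶜ Q) (hQg : Q g = 1) : Q ∈ N.boundedComplex g := by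
  refine ⟨hQ.mem_covectors, hQg, fun Y hY hYQ => or_iff_not_imp_left.2 fun hY0 => ?_⟩
  rw [← hQg]
  exact (hYQ g).resolve_left
    (hg.apply_ne_zero_of_isCocircuitOn hQ hY hY0 fun f _ hf => hYQ.eq_zero hf)

lemma exists_mem_boundedComplex [Finite α] (hg : N.IsGenericElement g) {P : α → SignType}
    (hP : P ∈ N.covectors) (hP0 : P ≠ 0) :
    ∃ X ∈ N.boundedComplex g, ∀ f ≠ g, P f = 0 → X f = 0 := by
  obtain ⟨Q, hQ, hPQ⟩ := exists_isCocircuitOn hP (A := {g}ᶜ) (by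
    by_contra! h
    exact hP0 (hg.transversal_compl P hP h))
  have hQ0 : Q ≠ 0 := by
    rintro rfl
    simpa using hQ.exists_ne_zero
  have hQg := hg.apply_ne_zero_of_isCocircuitOn hQ hQ.mem_covectors hQ0 fun _ _ h => h
  rcases signType_eq_or_eq_neg hQg one_ne_zero with h | h
  · exact ⟨Q, hg.mem_boundedComplex_of_isCocircuitOn hQ h, hPQ⟩
  · refine ⟨-Q, hg.mem_boundedComplex_of_isCocircuitOn hQ.neg (by simp [h]), fun f hf hPf => ?_⟩
    simp [hPQ f hf hPf]

end IsGenericElement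

lemma exists_eqOn_of_signComp_notMem_boundedComplex {R : α → SignType}
    (hX : X ∈ N.boundedComplex g) (hR : N.IsCocircuitOn {f | X f = 0} R)
    (hXR : signComp X R ∉ N.boundedComplex g) :
    ∃ Y ∈ N.covectors, Y g = 0 ∧ (∀ f, X f = 0 → Y f = R f) ∧ SignFaceOn {f | X f ≠ 0} Y X := by
  have hXg : X g = 1 := hX.2.1
  obtain ⟨Y, hY, hYXR, hY0, hYg⟩ := exists_signFace_of_notMem_boundedComplex
    (N.comp_mem X hX.1 R hR.mem_covectors) (by simp [signComp, hXg]) hXR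
  have hYX : SignFaceOn {f | X f ≠ 0} Y X := fun f (hf : X f ≠ 0) => by
    simpa [signComp, hf] using hYXR f
  have hYR : ∀ f, X f = 0 → Y f = 0 ∨ Y f = R f := fun f hf => by
    simpa [signComp, hf] using hYXR f
  refine ⟨Y, hY, hYg, fun f hf => (hYR f hf).elim (fun hYf => ?_) id, hYX⟩
  by_contra hRf
  have hY_zero : ∀ f, X f = 0 → Y f = 0 := hR.eq_zero_of_exists Y hY
    (fun f hf h => by simpa [h] using hYR f hf) ⟨f, hf, fun h => hRf (hYf.trans h.symm), hYf⟩
  refine hY0 (eq_zero_of_mem_boundedComplex hX hY (fun f => ?_) hYg)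
  by_cases hf : X f = 0
  · exact Or.inl (hY_zero f hf)
  · exact hYX f hf

namespace IsGenericElement

-- If both compositions had faces vanishing at `g`, eliminating between these two faces would show
-- that they live on the zero set of `X`, where genericity contradicts the minimality of `Q`.
lemma signComp_mem_boundedComplex_or (hg : N.IsGenericElement g) {Q : α → SignType}
    (hX : X ∈ N.boundedComplex g) (hQ : N.IsCocircuitOn {f | X f = 0} Q) :
    signComp X Q ∈ N.boundedComplex g ∨ signComp X (-Q) ∈ N.boundedComplex g := by
  by_contra! h
  have hXg : X g = 1 := hX.2.1
  obtain ⟨Y, hY, hYg, hYQ, hYX⟩ := exists_eqOn_of_signComp_notMem_boundedComplex hX hQ h.1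
  obtain ⟨Z, hZ, hZg, hZQ, hZX⟩ := exists_eqOn_of_signComp_notMem_boundedComplex hX hQ.neg h.2
  obtain ⟨e, hXe : X e = 0, hQe⟩ := hQ.exists_ne_zero
  have hYe : Y e ≠ 0 := hYQ e hXe ▸ hQe
  obtain ⟨W, hW, hWe, hWX, hW0⟩ := exists_elim_signFaceOn hY hZ (e := e)
    ⟨hYe, by simp [hYQ e hXe, hZQ e hXe]⟩ hYX hZX
  have hW_zero : ∀ f, X f = 0 → W f = 0 := hQ.eq_zero_of_exists W hW
    (fun f hf hQf => hW0 f (by rw [hYQ f hf, hQf]) (by simp [hZQ f hf, hQf])) ⟨e, hXe, hQe, hWe⟩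
  have hWX_face : SignFace W X := fun f => by
    by_cases hf : X f = 0
    · exact Or.inl (hW_zero f hf)
    · exact hWX f hf ▸ hYX.signComp hZX f hf
  have hY_zero : ∀ f, X f ≠ 0 → Y f = 0 := fun f hf => by
    have hWf : W f = 0 :=
      congrFun (eq_zero_of_mem_boundedComplex hX hW hWX_face (hW0 g hYg hZg)) f
    exact (signComp_eq_zero.1 (hWX f hf ▸ hWf)).1
  obtain ⟨U, hU, hU0, hYU, a, hag, hYa, hUa⟩ :=
    hg.exists_eq_zero_and_ne_zero hY (fun h => hYe (congrFun h e)) hYg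
  have hXa : X a = 0 := not_imp_comm.1 (hY_zero a) hYa
  have hU_zero : ∀ f, X f = 0 → U f = 0 := hQ.eq_zero_of_exists U hU
    (fun f hf hQf => hYU f (by rintro rfl; simp [hXg] at hf) (by rw [hYQ f hf, hQf]))
    ⟨a, hXa, hYQ a hXa ▸ hYa, hUa⟩
  refine hU0 (hg.transversal_compl U hU fun f hfg => ?_)
  by_cases hf : X f = 0
  · exact hU_zero f hf
  · exact hYU f hfg (hY_zero f hf)

lemma exists_boundedComplex_extend_of_ne_zero [Finite α] (hg : N.IsGenericElement g)
    {P : α → SignType} (hX : X ∈ N.boundedComplex g) (hP : P ∈ N.covectors)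
    (hXP : ∃ e, X e = 0 ∧ P e ≠ 0) :
    ∃ X' ∈ N.boundedComplex g, SignFace X X' ∧ (∃ e, X e = 0 ∧ X' e ≠ 0) ∧
      ∀ f, X f = 0 → P f = 0 → X' f = 0 := by
  obtain ⟨Q, hQ, hPQ⟩ := exists_isCocircuitOn (A := {f | X f = 0}) hP hXP
  obtain ⟨e, hXe : X e = 0, hQe⟩ := hQ.exists_ne_zero
  rcases hg.signComp_mem_boundedComplex_or hX hQ with h | h
  · exact ⟨_, h, signFace_signComp X _, ⟨e, hXe, fun h => hQe (signComp_eq_zero.1 h).2⟩,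
      fun f hXf hPf => signComp_eq_zero.2 ⟨hXf, hPQ f hXf hPf⟩⟩
  · exact ⟨_, h, signFace_signComp X _,
      ⟨e, hXe, fun h => hQe (by simpa using (signComp_eq_zero.1 h).2)⟩,
      fun f hXf hPf => signComp_eq_zero.2 ⟨hXf, by simp [hPQ f hXf hPf]⟩⟩

lemma exists_boundedComplex_extend [Finite α] (hg : N.IsGenericElement g) {P : α → SignType}
    (hX : X ∈ N.boundedComplex g) (hP : P ∈ N.covectors) :
    ∃ X' ∈ N.boundedComplex g, SignFace X X' ∧ ∀ f, X' f = 0 ↔ X f = 0 ∧ P f = 0 := by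
  obtain ⟨Z, -, hZ⟩ := (Set.toFinite {Z : Set α | ∃ X' ∈ N.boundedComplex g, SignFace X X' ∧
    (∀ f, X f = 0 → P f = 0 → X' f = 0) ∧ Z = {f | X' f = 0}}).exists_le_minimal
    ⟨X, hX, fun _ => Or.inr rfl, fun _ h _ => h, rfl⟩
  obtain ⟨X', hX', hXX', h0, rfl⟩ := hZ.prop
  refine ⟨X', hX', hXX', fun f => ⟨fun hf => ⟨hXX'.eq_zero hf, ?_⟩, fun h => h0 f h.1 h.2⟩⟩
  by_contra hPf
  obtain ⟨X'', hX'', hXX'', ⟨e, he, he'⟩, h0'⟩ :=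
    hg.exists_boundedComplex_extend_of_ne_zero hX' hP ⟨f, hf, hPf⟩
  exact he' (hZ.le_of_le ⟨X'', hX'', hXX'.trans hXX'', fun f h1 h2 => h0' f (h0 f h1 h2) h2, rfl⟩
    (fun f hf => hXX''.eq_zero hf) he)

lemma mem_boundedTopes_iff [Finite α] (hg : N.IsGenericElement g) :
    X ∈ N.boundedTopes g ↔ X ∈ N.boundedComplex g ∧ ∀ e, X e = 0 → N.Spans ∅ e := by
  refine ⟨fun ⟨hX, hmax⟩ => ⟨hX, fun e he => ?_⟩, fun ⟨hX, h0⟩ => ⟨hX, fun Y hY hXY => ?_⟩⟩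
  · obtain ⟨P, hP, hPe⟩ := N.exists_eq_zero_iff_spans_empty
    obtain ⟨X', hX', hXX', h0⟩ := hg.exists_boundedComplex_extend hX hP
    rw [← hmax X' hX' hXX'] at he
    exact (hPe e).1 ((h0 e).1 he).2
  · exact (isTope_of_spans_empty hX.1 h0).2 Y hY.1 hXY

lemma exists_boundedComplex_of_chain [Finite α] {ι : Type*} [LinearOrder ι]
    (hg : N.IsGenericElement g) {P : ι → α → SignType} (hP : ∀ i, P i ∈ N.covectors)
    (hP_mono : ∀ i j, i ≤ j → ∀ f ≠ g, P i f = 0 → P j f = 0)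
    {Q : α → SignType} (hQ : Q ∈ N.covectors) (hQ0 : Q ≠ 0) (s : Finset ι)
    (hPQ : ∀ i ∈ s, ∀ f ≠ g, P i f = 0 → Q f = 0) :
    ∃ T ∈ N.boundedComplex g, (∀ f ≠ g, Q f = 0 → (∀ i ∈ s, P i f = 0) → T f = 0) ∧
      ∀ i ∈ s, ∃ X ∈ N.covectors, SignFace X T ∧ ∀ f ≠ g, X f = 0 ↔ P i f = 0 := by
  classical
  induction s using Finset.induction_on_min with
  | empty =>
    obtain ⟨T, hT, hQT⟩ := hg.exists_mem_boundedComplex hQ hQ0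
    exact ⟨T, hT, fun f hf h _ => hQT f hf h, by simp⟩
  | insert i s his ih =>
    obtain ⟨T, hT, hTQ, hTs⟩ := ih fun j hj => hPQ j (Finset.mem_insert_of_mem hj)
    obtain ⟨T', hT', hTT', hT'_zero⟩ := hg.exists_boundedComplex_extend hT (hP i)
    have hPT : ∀ f ≠ g, P i f = 0 → T f = 0 := fun f hf h =>
      hTQ f hf (hPQ i (Finset.mem_insert_self i s) f hf h)
        fun j hj => hP_mono i j (his j hj).le f hf h
    refine ⟨T', hT', fun f hf _ h => ?_, fun j hj => ?_⟩
    · have hif := h i (Finset.mem_insert_self i s)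
      exact (hT'_zero f).2 ⟨hPT f hf hif, hif⟩
    · rcases Finset.mem_insert.1 hj with rfl | hj
      · refine ⟨T', hT'.1, fun _ => Or.inr rfl, fun f hf => ?_⟩
        rw [hT'_zero f]
        exact and_iff_right_of_imp (hPT f hf)
      · obtain ⟨X, hX, hXT, hX0⟩ := hTs j hj
        exact ⟨X, hX, hXT.trans hTT', hX0⟩

end IsGenericElement

end OrientedMatroid

namespace OrientedMatroid

variable {α : Type*} {N : OrientedMatroid α}

/-- The contraction of `F`, on the same ground set: the elements of `F` become loops. -/
def contract (N : OrientedMatroid α) (F : Set α) : OrientedMatroid α where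
  covectors := {X ∈ N.covectors | ∀ e ∈ F, X e = 0}
  zero_mem := ⟨N.zero_mem, fun _ _ => rfl⟩
  neg_mem X hX := ⟨N.neg_mem X hX.1, fun e he => by simp [hX.2 e he]⟩
  comp_mem X hX Y hY := ⟨N.comp_mem X hX.1 Y hY.1, fun e he =>
    signComp_eq_zero.2 ⟨hX.2 e he, hY.2 e he⟩⟩
  elim X hX Y hY e he := by
    obtain ⟨Z, hZ, hZe, hZf⟩ := N.elim X hX.1 Y hY.1 e he
    refine ⟨Z, ⟨hZ, fun f hf => ?_⟩, hZe, hZf⟩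
    rw [hZf f fun h => h.1 (hX.2 f hf)]
    exact signComp_eq_zero.2 ⟨hX.2 f hf, hY.2 f hf⟩

/-- The deletion of `e`, on the same ground set: `e` becomes a loop. -/
def delete [DecidableEq α] (N : OrientedMatroid α) (e : α) : OrientedMatroid α where
  covectors := (fun X => Function.update X e 0) '' N.covectors
  zero_mem := ⟨0, N.zero_mem, by simp⟩
  neg_mem := by
    rintro _ ⟨X, hX, rfl⟩
    refine ⟨-X, N.neg_mem X hX, funext fun f => ?_⟩
    by_cases h : f = e <;> simp [h]
  comp_mem := by
    rintro _ ⟨X, hX, rfl⟩ _ ⟨Y, hY, rfl⟩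
    refine ⟨signComp X Y, N.comp_mem X hX Y hY, funext fun f => ?_⟩
    by_cases h : f = e <;> simp [signComp, h]
  elim := by
    rintro _ ⟨X, hX, rfl⟩ _ ⟨Y, hY, rfl⟩ f hf
    have hfe : f ≠ e := by
      rintro rfl
      exact hf.1 (by simp)
    have hsep : ∀ f, f ≠ e → (SignSep (Function.update X e 0) (Function.update Y e 0) f ↔
        SignSep X Y f) := fun f hf => by simp [SignSep, hf]
    obtain ⟨Z, hZ, hZf, hZ'⟩ := N.elim X hX Y hY f ((hsep f hfe).1 hf)
    refine ⟨_, ⟨Z, hZ, rfl⟩, by simp [Function.update_apply, hZf], fun f' hf' => ?_⟩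
    by_cases h : f' = e
    · simp [h, signComp]
    · simp [h, hZ' f' (mt (hsep f' h).2 hf'), signComp]

lemma mem_covectors_contract {F : Set α} {X : α → SignType} :
    X ∈ (N.contract F).covectors ↔ X ∈ N.covectors ∧ ∀ e ∈ F, X e = 0 := Iff.rfl

lemma spans_contract_iff {F A : Set α} {e : α} :
    (N.contract F).Spans A e ↔ N.Spans (A ∪ F) e := by
  simp only [Spans, mem_covectors_contract, Set.mem_union, or_imp, forall_and, and_imp]
  exact forall₂_congr fun X _ => forall_comm

lemma transversal_contract_iff {F A : Set α} :
    (N.contract F).Transversal A ↔ N.Transversal (A ∪ F) := by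
  simp only [Transversal, mem_covectors_contract, Set.mem_union, or_imp, forall_and, and_imp]
  exact forall₂_congr fun X _ => forall_comm

lemma mem_boundedComplex_contract {F : Set α} {g : α} {X : α → SignType} :
    X ∈ (N.contract F).boundedComplex g ↔ X ∈ N.boundedComplex g ∧ ∀ e ∈ F, X e = 0 := by
  constructor
  · rintro ⟨hX, hXg, h⟩
    exact ⟨⟨hX.1, hXg, fun Y hY hYX => h Y ⟨hY, fun e he => hYX.eq_zero (hX.2 e he)⟩ hYX⟩, hX.2⟩
  · rintro ⟨⟨hX, hXg, h⟩, hXF⟩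
    exact ⟨⟨hX, hXF⟩, hXg, fun Y hY => h Y hY.1⟩

lemma IsGenericElement.contract {F : Set α} {g : α} (hg : N.IsGenericElement g) (hgF : g ∉ F)
    (hF : ¬ N.Transversal F) : (N.contract F).IsGenericElement g where
  not_isLoop h := hF (hg.transversal_of_spans F hgF (by simpa using spans_contract_iff.1 h))
  not_isColoop := spans_contract_iff.2 fun X hX h =>
    hg.not_isColoop X hX fun a ha => h a (Or.inl ha)
  transversal_of_spans A hgA h := transversal_contract_iff.2 <|
    hg.transversal_of_spans _ (by simp [hgA, hgF]) (spans_contract_iff.1 h)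

/-- `ε` behaves like `A ↦ (-1) ^ r(A)` for the rank function `r` of `N`. -/
structure IsRankSign (N : OrientedMatroid α) (ε : Set α → ℤ) : Prop where
  insert_eq : ∀ {A e}, N.Spans A e → ε (insert e A) = ε A
  insert_eq_neg : ∀ {A e}, ¬ N.Spans A e → ε (insert e A) = - ε A

lemma IsRankSign.contract {ε : Set α → ℤ} (hε : N.IsRankSign ε) (F : Set α) :
    (N.contract F).IsRankSign fun A => ε (A ∪ F) where
  insert_eq h := by
    rw [Set.insert_union]
    exact hε.insert_eq (spans_contract_iff.1 h)
  insert_eq_neg h := by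
    rw [Set.insert_union]
    exact hε.insert_eq_neg (mt spans_contract_iff.2 h)

section Delete

variable [DecidableEq α] {e g : α} {Y : α → SignType}

lemma mem_covectors_delete :
    Y ∈ (N.delete e).covectors ↔ Y e = 0 ∧ ∃ s, Function.update Y e s ∈ N.covectors := by
  constructor
  · rintro ⟨X, hX, rfl⟩
    exact ⟨by simp, X e, by simpa using hX⟩
  · rintro ⟨hYe, s, hs⟩
    exact ⟨_, hs, by simp [← hYe]⟩

lemma forall_update_zero_eq_zero_iff {A : Set α} {X : α → SignType} :
    (∀ a ∈ A, Function.update X e 0 a = 0) ↔ ∀ a ∈ A \ {e}, X a = 0 := by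
  refine ⟨fun h a ha => ?_, fun h a ha => ?_⟩
  · simpa [show a ≠ e from ha.2] using h a ha.1
  · by_cases hae : a = e
    · simp [hae]
    · simpa [hae] using h a ⟨ha, hae⟩

lemma spans_delete_iff {A : Set α} {f : α} (hf : f ≠ e) :
    (N.delete e).Spans A f ↔ N.Spans (A \ {e}) f := by
  simp only [Spans, delete, Set.forall_mem_image, forall_update_zero_eq_zero_iff,
    Function.update_of_ne hf]

lemma spans_delete_self {A : Set α} : (N.delete e).Spans A e := by
  rintro _ ⟨X, -, rfl⟩ -
  simp

lemma Transversal.delete {A : Set α} (h : N.Transversal (A \ {e})) :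
    (N.delete e).Transversal A := by
  rintro _ ⟨X, hX, rfl⟩ hXA
  rw [h X hX (forall_update_zero_eq_zero_iff.1 hXA)]
  simp

lemma IsGenericElement.delete (hg : N.IsGenericElement g) (heg : e ≠ g)
    (he : N.Transversal ({g}ᶜ \ {e})) : (N.delete e).IsGenericElement g where
  not_isLoop h := hg.not_isLoop (by simpa using (spans_delete_iff heg.symm).1 h)
  not_isColoop := (spans_delete_iff heg.symm).2 fun X hX h => congrFun (he X hX h) g
  transversal_of_spans A hgA h := Transversal.delete <|
    hg.transversal_of_spans _ (fun h => hgA h.1) ((spans_delete_iff heg.symm).1 h)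

lemma IsRankSign.delete {ε : Set α → ℤ} (hε : N.IsRankSign ε) (e : α) :
    (N.delete e).IsRankSign fun A => ε (A \ {e}) where
  insert_eq {A f} h := by
    by_cases hf : f = e
    · simp [hf]
    · rw [Set.insert_sdiff_of_notMem _ (by simpa using hf)]
      exact hε.insert_eq ((spans_delete_iff hf).1 h)
  insert_eq_neg {A f} h := by
    have hf : f ≠ e := by
      rintro rfl
      exact h spans_delete_self
    rw [Set.insert_sdiff_of_notMem _ (by simpa using hf)]
    exact hε.insert_eq_neg (mt (spans_delete_iff hf).2 h)

end Delete

section Fiber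

variable [DecidableEq α] {e g : α} {X Y Z : α → SignType} {s t : SignType}

lemma setOf_update_eq_zero (ht : t ≠ 0) :
    {f | Function.update Y e t f = 0} = {f | Y f = 0} \ {e} := by
  ext f
  by_cases hf : f = e
  · subst hf; simp [ht]
  · simp [hf]

lemma setOf_update_zero_eq_zero :
    {f | Function.update Y e 0 f = 0} = insert e ({f | Y f = 0} \ {e}) := by
  ext f
  by_cases hf : f = e
  · subst hf; simp
  · simp [hf]

lemma signFace_update_iff : SignFace Z (Function.update Y e s) ↔
    (Z e = 0 ∨ Z e = s) ∧ SignFaceOn {e}ᶜ Z Y := by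
  refine ⟨fun h => ⟨by simpa using h e, fun f (hf : f ≠ e) => by simpa [hf] using h f⟩, ?_⟩
  rintro ⟨hZe, hZ⟩ f
  by_cases hf : f = e
  · subst hf; simpa using hZe
  · simpa [hf] using hZ f hf

lemma update_mem_covectors_of_update_zero (h0 : Function.update Y e 0 ∈ N.covectors)
    (hZ : Z ∈ N.covectors) (hYZ : ∀ f ≠ e, Y f = 0 → Z f = 0) :
    Function.update Y e (Z e) ∈ N.covectors := by
  convert N.comp_mem _ h0 Z hZ using 1
  funext f
  by_cases hf : f = e
  · subst hf; simp [signComp]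
  · by_cases hYf : Y f = 0 <;> simp [signComp, hf, hYf, hYZ f hf]

lemma update_zero_mem_covectors (hs : Function.update Y e s ∈ N.covectors) (hs0 : s ≠ 0)
    (hZ : Z ∈ N.covectors) (hZY : SignFaceOn {e}ᶜ Z Y) (hZe : Z e = -s) :
    Function.update Y e 0 ∈ N.covectors := by
  have hY : SignFaceOn {e}ᶜ (Function.update Y e s) Y := fun f (hf : f ≠ e) =>
    Or.inr (by simp [hf])
  obtain ⟨W, hW, hWe, hWf, -⟩ := exists_elim_signFaceOn hs hZ (e := e)
    ⟨by simpa using hs0, by simp [hZe]⟩ hY hZY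
  convert hW using 1
  funext f
  by_cases hf : f = e
  · subst hf; simp [hWe]
  · rw [hWf f hf]
    rcases hZY f hf with h | h <;> simp +contextual [signComp, hf, h]

lemma eq_zero_of_update_mem_covectors (h : N.Spans ({f | Y f = 0} \ {e}) e)
    (hs : Function.update Y e s ∈ N.covectors) : s = 0 := by
  simpa using h _ hs fun a ha => by simpa [show a ≠ e from ha.2] using ha.1

lemma update_mem_covectors_of_not_spans (h : ¬ N.Spans ({f | Y f = 0} \ {e}) e)
    (h0 : Function.update Y e 0 ∈ N.covectors) (s : SignType) :
    Function.update Y e s ∈ N.covectors := by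
  obtain ⟨V, hV, hVY, hVe⟩ := not_spans_iff.1 h
  have hYV : ∀ f ≠ e, Y f = 0 → V f = 0 := fun f hf hYf => hVY f ⟨hYf, hf⟩
  by_cases hs0 : s = 0
  · exact hs0 ▸ h0
  rcases signType_eq_or_eq_neg hs0 hVe with rfl | rfl
  · exact update_mem_covectors_of_update_zero h0 hV hYV
  · exact update_mem_covectors_of_update_zero h0 (N.neg_mem V hV) (by simpa using hYV)

lemma sum_signType_eq (ht : t ≠ 0) (F : SignType → ℤ) : ∑ s, F s = F 0 + F t + F (-t) := by
  rw [SignType.univ_eq]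
  rcases signType_eq_or_eq_neg ht one_ne_zero with rfl | rfl <;> simp <;> ring

lemma IsRankSign.update_zero {ε : Set α → ℤ} (hε : N.IsRankSign ε) (hX : X ∈ N.covectors)
    (hXe : X e ≠ 0) : ε {f | Function.update X e 0 f = 0} = -ε {f | X f = 0} := by
  rw [setOf_update_zero_eq_zero, Set.sdiff_singleton_eq_self (show e ∉ {f | X f = 0} from hXe)]
  exact hε.insert_eq_neg fun h => hXe (h X hX fun _ ha => ha)

lemma IsRankSign.sum_indicator_covectors {ε : Set α → ℤ} (hε : N.IsRankSign ε)
    (hs : Function.update Y e s ∈ N.covectors) :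
    ∑ t, N.covectors.indicator (fun X => ε {f | X f = 0}) (Function.update Y e t) =
      ε ({f | Y f = 0} \ {e}) := by
  have hone : (1 : SignType) ≠ 0 := by decide
  by_cases hspan : N.Spans ({f | Y f = 0} \ {e}) e
  · have hmem (t : SignType) (ht : t ≠ 0) : Function.update Y e t ∉ N.covectors :=
      fun h => ht (eq_zero_of_update_mem_covectors hspan h)
    obtain rfl := eq_zero_of_update_mem_covectors hspan hs
    rw [sum_signType_eq hone, Set.indicator_of_mem hs, Set.indicator_of_notMem (hmem _ hone),
      Set.indicator_of_notMem (hmem _ (by decide)), setOf_update_zero_eq_zero,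
      hε.insert_eq hspan, add_zero, add_zero]
  by_cases h0 : Function.update Y e 0 ∈ N.covectors
  · have hmem := update_mem_covectors_of_not_spans hspan h0
    rw [sum_signType_eq hone, Set.indicator_of_mem (hmem _), Set.indicator_of_mem (hmem _),
      Set.indicator_of_mem (hmem _), setOf_update_zero_eq_zero, hε.insert_eq_neg hspan,
      setOf_update_eq_zero hone, setOf_update_eq_zero (by decide)]
    ring
  · have hs0 : s ≠ 0 := by
      rintro rfl
      exact h0 hs
    have hns : Function.update Y e (-s) ∉ N.covectors := fun h =>
      h0 (update_zero_mem_covectors hs hs0 h (fun f (hf : f ≠ e) => Or.inr (by simp [hf]))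
        (by simp))
    rw [sum_signType_eq hs0, Set.indicator_of_notMem h0, Set.indicator_of_mem hs,
      Set.indicator_of_notMem hns, setOf_update_eq_zero hs0, zero_add, add_zero]

lemma IsRankSign.sum_indicator_boundedComplex_eq_zero {ε : Set α → ℤ} (hε : N.IsRankSign ε)
    (ht : t ≠ 0)
    (h : ∀ s, Function.update Y e s ∈ N.boundedComplex g ↔ s = 0 ∨ s = t) :
    ∑ s, (N.boundedComplex g).indicator (fun X => ε {f | X f = 0}) (Function.update Y e s) =
      0 := by
  have htB : Function.update Y e t ∈ N.boundedComplex g := (h t).2 (Or.inr rfl)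
  have hneg : Function.update Y e (-t) ∉ N.boundedComplex g :=
    mt (h _).1 (by simpa [SignType.neg_eq_self_iff] using ht)
  have hε0 := hε.update_zero (e := e) htB.1 (by simpa using ht)
  rw [Function.update_idem] at hε0
  rw [sum_signType_eq ht, Set.indicator_of_mem ((h 0).2 (Or.inl rfl)), Set.indicator_of_mem htB,
    Set.indicator_of_notMem hneg, hε0]
  ring

lemma mem_boundedComplex_delete (heg : e ≠ g) (he : N.Transversal {e}ᶜ) :
    Y ∈ (N.delete e).boundedComplex g ↔ Y ∈ (N.delete e).covectors ∧ Y g = 1 ∧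
      ∀ Z ∈ N.covectors, SignFaceOn {e}ᶜ Z Y → Z = 0 ∨ Z g = 1 := by
  refine and_congr_right fun _ => and_congr_right fun _ => ?_
  simp only [delete, Set.forall_mem_image]
  refine forall₂_congr fun Z hZ => imp_congr ?_ (or_congr ?_ (by simp [heg.symm]))
  · refine ⟨fun h f (hf : f ≠ e) => by simpa [hf] using h f, fun h f => ?_⟩
    by_cases hf : f = e
    · simp [hf]
    · simpa [hf] using h f hf
  · refine ⟨fun h => he Z hZ fun f (hf : f ≠ e) => ?_, fun h => by simp [h]⟩
    simpa [hf] using congrFun h f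

lemma update_mem_boundedComplex_iff_of_mem_delete (heg : e ≠ g) (he : N.Transversal {e}ᶜ)
    (hY : Y ∈ (N.delete e).boundedComplex g) :
    Function.update Y e s ∈ N.boundedComplex g ↔ Function.update Y e s ∈ N.covectors :=
  have ⟨_, hYg, hYZ⟩ := (mem_boundedComplex_delete heg he).1 hY
  ⟨fun h => h.1, fun h => ⟨h, by simpa [heg.symm] using hYg,
    fun Z hZ hZY => hYZ Z hZ (signFace_update_iff.1 hZY).2⟩⟩

lemma update_neg_mem_boundedComplex (heg : e ≠ g) (he : N.Transversal {e}ᶜ)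
    (h0 : Function.update Y e 0 ∈ N.boundedComplex g) (hZ : Z ∈ N.covectors)
    (hZY : SignFaceOn {e}ᶜ Z Y) (hZg : Z g = 0) (hZe : Z e ≠ 0) :
    Function.update Y e (-Z e) ∈ N.boundedComplex g := by
  have hmem : Function.update Y e (-Z e) ∈ N.covectors :=
    update_mem_covectors_of_update_zero h0.1 (N.neg_mem Z hZ) fun f hf hYf => by
      simpa [hYf] using hZY f hf
  by_contra hb
  obtain ⟨V, hV, hVY, hV0, hVg⟩ := exists_signFace_of_notMem_boundedComplex hmem
    (by simpa [heg.symm] using h0.2.1) hb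
  obtain ⟨hVe, hVY⟩ := signFace_update_iff.1 hVY
  have hVe : V e = -Z e := hVe.resolve_left fun hVe =>
    hV0 (eq_zero_of_mem_boundedComplex h0 hV (signFace_update_iff.2 ⟨Or.inl hVe, hVY⟩) hVg)
  obtain ⟨W, hW, hWe, hWf, hW0⟩ := exists_elim_signFaceOn hZ hV (e := e) ⟨hZe, by simp [hVe]⟩
    hZY hVY
  have hWY : SignFaceOn {e}ᶜ W Y := fun f hf => hWf f hf ▸ hZY.signComp hVY f hf
  have hW_zero : W = 0 := eq_zero_of_mem_boundedComplex h0 hW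
    (signFace_update_iff.2 ⟨Or.inl hWe, hWY⟩) (hW0 g hZg hVg)
  refine hZe (congrFun (he Z hZ fun f hf => ?_) e)
  have hZV : signComp Z V f = 0 := by rw [← hWf f hf, hW_zero]; rfl
  exact (signComp_eq_zero.1 hZV).1

lemma exists_update_mem_boundedComplex_iff (heg : e ≠ g) (he : N.Transversal {e}ᶜ)
    (hYe : Y e = 0) (hY : Y ∉ (N.delete e).boundedComplex g)
    (hs : Function.update Y e s ∈ N.boundedComplex g) :
    ∃ t ≠ 0, ∀ s, Function.update Y e s ∈ N.boundedComplex g ↔ s = 0 ∨ s = t := by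
  have hYg : Y g = 1 := by simpa [heg.symm] using hs.2.1
  obtain ⟨Z, hZ, hZY, hZ0, hZg⟩ :
      ∃ Z ∈ N.covectors, SignFaceOn {e}ᶜ Z Y ∧ Z ≠ 0 ∧ Z g ≠ 1 := by
    by_contra! hc
    exact hY ((mem_boundedComplex_delete heg he).2 ⟨mem_covectors_delete.2 ⟨hYe, s, hs.1⟩, hYg,
      fun Z hZ hZY => or_iff_not_imp_left.2 (hc Z hZ hZY)⟩)
  have hZg : Z g = 0 := (hZY g heg.symm).resolve_right (hYg ▸ hZg)
  have hZe (s : SignType) (hs : Function.update Y e s ∈ N.boundedComplex g) :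
      ¬ (Z e = 0 ∨ Z e = s) := fun h =>
    hZ0 (eq_zero_of_mem_boundedComplex hs hZ (signFace_update_iff.2 ⟨h, hZY⟩) hZg)
  have hZe0 : Z e ≠ 0 := fun h => hZe s hs (Or.inl h)
  have hmem (s : SignType) (hs : Function.update Y e s ∈ N.boundedComplex g) :
      s = 0 ∨ s = -Z e := or_iff_not_imp_left.2 fun hs0 =>
    (signType_eq_or_eq_neg hs0 hZe0).resolve_left fun h => hZe s hs (Or.inr h.symm)
  have h0 : Function.update Y e 0 ∈ N.boundedComplex g := by
    rcases hmem s hs with rfl | rfl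
    · exact hs
    · refine mem_boundedComplex_of_signFace hs ?_
        (signFace_update_iff.2 ⟨Or.inl (by simp), fun f (hf : f ≠ e) => Or.inr (by simp [hf])⟩)
        fun h => by simpa [heg.symm, hYg] using congrFun h g
      exact update_zero_mem_covectors hs.1 (by simpa using hZe0) hZ hZY (by simp)
  refine ⟨-Z e, by simpa using hZe0, fun s => ⟨hmem s, ?_⟩⟩
  rintro (rfl | rfl)
  · exact h0
  · exact update_neg_mem_boundedComplex heg he h0 hZ hZY hZg hZe0

end Fiber

end OrientedMatroid

lemma sum_eq_sum_sum_update {α β R : Type*} [Fintype α] [DecidableEq α] [Fintype β]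
    [DecidableEq β] [AddCommMonoid R] (e : α) (b : β) (F : (α → β) → R) :
    ∑ X, F X = ∑ Y with Y e = b, ∑ s, F (Function.update Y e s) := by
  rw [← Finset.sum_product']
  exact Finset.sum_bij' (fun X _ => (Function.update X e b, X e))
    (fun p _ => Function.update p.1 e p.2) (by simp) (by simp) (by simp)
    (by rintro ⟨Y, s⟩ h; simp_all) (by simp)

namespace OrientedMatroid

variable {α : Type*} {N : OrientedMatroid α} {g e : α} {ε : Set α → ℤ}

/-- The sum of `ε` over the zero sets of the bounded covectors. If `ε` is the sign of the rank,
then this is an alternating count of the bounded covectors by dimension, that is the Euler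
characteristic of the bounded complex up to sign. -/
noncomputable def boundedSum (N : OrientedMatroid α) (g : α) (ε : Set α → ℤ) : ℤ :=
  ∑ᶠ X ∈ N.boundedComplex g, ε {e | X e = 0}

lemma boundedSum_eq_sum_indicator [Fintype α] [DecidableEq α] :
    N.boundedSum g ε =
      ∑ X, (N.boundedComplex g).indicator (fun X => ε {e | X e = 0}) X := by
  rw [boundedSum, finsum_mem_def, finsum_eq_sum_of_fintype]

lemma boundedSum_delete [Finite α] [DecidableEq α] (hε : N.IsRankSign ε) (heg : e ≠ g)
    (he : N.Transversal {e}ᶜ) :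
    (N.delete e).boundedSum g (fun A => ε (A \ {e})) = N.boundedSum g ε := by
  have := Fintype.ofFinite α
  rw [boundedSum_eq_sum_indicator, boundedSum_eq_sum_indicator,
    sum_eq_sum_sum_update (R := ℤ) e 0, sum_eq_sum_sum_update (R := ℤ) e 0]
  refine Finset.sum_congr rfl fun Y hY => ?_
  have hYe : Y e = 0 := by simpa using hY
  rw [Finset.sum_eq_single (0 : SignType) ?_ (by simp),
    show Function.update Y e 0 = Y by rw [← hYe, Function.update_eq_self]]
  · by_cases hYd : Y ∈ (N.delete e).boundedComplex g
    · obtain ⟨s, hs⟩ := (mem_covectors_delete.1 hYd.1).2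
      rw [Set.indicator_of_mem hYd, ← hε.sum_indicator_covectors hs]
      refine Finset.sum_congr rfl fun s _ => ?_
      have hmem := update_mem_boundedComplex_iff_of_mem_delete (s := s) heg he hYd
      by_cases hYs : Function.update Y e s ∈ N.covectors
      · rw [Set.indicator_of_mem hYs, Set.indicator_of_mem (hmem.2 hYs)]
      · rw [Set.indicator_of_notMem hYs, Set.indicator_of_notMem (mt hmem.1 hYs)]
    · rw [Set.indicator_of_notMem hYd]
      by_cases hex : ∃ s, Function.update Y e s ∈ N.boundedComplex g
      · obtain ⟨s, hs⟩ := hex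
        obtain ⟨t, ht, hst⟩ := exists_update_mem_boundedComplex_iff heg he hYe hYd hs
        exact (hε.sum_indicator_boundedComplex_eq_zero ht hst).symm
      · refine (Finset.sum_eq_zero fun s _ => ?_).symm
        exact Set.indicator_of_notMem (not_exists.1 hex s) _
  · intro s _ hs
    refine Set.indicator_of_notMem (fun h => hs ?_) _
    simpa using (mem_covectors_delete.1 h.1).1

lemma mem_boundedComplex_iff_signFaceOn (hg : N.Transversal {g}ᶜ) {X : α → SignType} :
    X ∈ N.boundedComplex g ↔ X ∈ N.covectors ∧ X g = 1 ∧
      ∀ Z ∈ N.covectors, SignFaceOn {g}ᶜ Z X → Z = 0 ∨ Z g = 1 := by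
  refine ⟨fun hX => ⟨hX.1, hX.2.1, fun Z hZ hZX => ?_⟩, fun ⟨hX, hXg, h⟩ => ⟨hX, hXg,
    fun Z hZ hZX => h Z hZ fun f _ => hZX f⟩⟩
  by_cases hZg : Z g = 0
  · refine Or.inl (eq_zero_of_mem_boundedComplex hX hZ (fun f => ?_) hZg)
    by_cases hf : f = g
    · exact Or.inl (hf ▸ hZg)
    · exact hZX f hf
  refine Or.inr ((signType_eq_or_eq_neg hZg one_ne_zero).resolve_right fun hZg => ?_)
  have hXg : X g = 1 := hX.2.1
  obtain ⟨W, hW, hWg, hWf, -⟩ := exists_elim_signFaceOn hX.1 hZ (e := g) ⟨by simp [hXg],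
    by simp [hXg, hZg]⟩ (fun f _ => Or.inr rfl) hZX
  have hWX : SignFace W X := fun f => by
    by_cases hf : f = g
    · exact Or.inl (hf ▸ hWg)
    · exact hWf f hf ▸ SignFaceOn.signComp (fun f _ => Or.inr rfl) hZX f hf
  have hW0 := eq_zero_of_mem_boundedComplex hX hW hWX hWg
  have hX0 : X = 0 := hg X hX.1 fun f hf =>
    (signComp_eq_zero.1 (by rw [← hWf f hf, hW0]; rfl : signComp X Z f = 0)).1
  simp [hX0] at hXg

/-- `C` is the vertex of the bounded complex that is supported on `{e, g}`. It exists if `e` is a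
coloop of the deletion of `g`, and then the bounded complex is a pyramid with apex `C` over its
covectors that vanish at `e`. -/
structure IsApex (N : OrientedMatroid α) (g e : α) (C : α → SignType) : Prop where
  mem_covectors : C ∈ N.covectors
  ne : e ≠ g
  apply_eq_one : C g = 1
  apply_ne_zero : C e ≠ 0
  eq_zero : ∀ f ≠ g, f ≠ e → C f = 0

lemma IsGenericElement.exists_isApex (hg : N.IsGenericElement g) (heg : e ≠ g)
    (he : ¬ N.Transversal ({g}ᶜ \ {e})) : ∃ C, N.IsApex g e C := by
  obtain ⟨V, hV, hV0, hVg⟩ := not_spans_iff.1 (mt (hg.transversal_of_spans _ (by simp)) he)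
  have hVe : V e ≠ 0 := fun hVe => hVg (congrFun (hg.transversal_compl V hV fun f hf => by
    by_cases hfe : f = e
    · rw [hfe, hVe]
    · exact hV0 f ⟨hf, hfe⟩) g)
  rcases signType_eq_or_eq_neg hVg one_ne_zero with h | h
  · exact ⟨V, hV, heg, h, hVe, fun f hfg hfe => hV0 f ⟨hfg, hfe⟩⟩
  · exact ⟨-V, N.neg_mem V hV, heg, by simp [h], by simpa using hVe,
      fun f hfg hfe => by simp [hV0 f ⟨hfg, hfe⟩]⟩

namespace IsApex

variable {C X : α → SignType}

lemma mem_boundedComplex (hC : N.IsApex g e C) (hg : N.IsGenericElement g) :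
    C ∈ N.boundedComplex g := by
  refine hg.mem_boundedComplex_of_isCocircuitOn
    ⟨hC.mem_covectors, ⟨e, hC.ne, hC.apply_ne_zero⟩, ?_⟩ hC.apply_eq_one
  rintro V - hVC ⟨a, hag, hCa, hVa⟩ f hf
  obtain rfl : a = e := not_imp_comm.1 (hC.eq_zero a hag) hCa
  by_cases hfa : f = a
  · rw [hfa, hVa]
  · exact hVC f hf (hC.eq_zero f hf hfa)

lemma apply_eq_zero_or (hC : N.IsApex g e C) (hg : N.Transversal {g}ᶜ)
    (hX : X ∈ N.boundedComplex g) : X e = 0 ∨ X e = C e := by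
  refine or_iff_not_imp_left.2 fun hXe =>
    (signType_eq_or_eq_neg hXe hC.apply_ne_zero).resolve_right fun hXC => ?_
  have hCX : SignFaceOn {g}ᶜ (-C) X := fun f hf => by
    by_cases hfe : f = e
    · exact Or.inr (by simp [hfe, hXC])
    · exact Or.inl (by simp [hC.eq_zero f hf hfe])
  rcases ((mem_boundedComplex_iff_signFaceOn hg).1 hX).2.2 (-C) (N.neg_mem C hC.mem_covectors) hCX
    with h | h
  · exact hC.apply_ne_zero (by simpa using congrFun h e)
  · exact absurd h (by rw [Pi.neg_apply, hC.apply_eq_one]; decide)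

variable [DecidableEq α]

lemma update_mem_boundedComplex [Finite α] (hC : N.IsApex g e C) (hg : N.IsGenericElement g)
    (hX : X ∈ N.boundedComplex g) : Function.update X e (C e) ∈ N.boundedComplex g := by
  obtain ⟨X', hX', hXX', hX'0⟩ := hg.exists_boundedComplex_extend hX hC.mem_covectors
  have hX'e : X' e = C e := (hC.apply_eq_zero_or hg.transversal_compl hX').resolve_left
    fun h => hC.apply_ne_zero ((hX'0 e).1 h).2
  convert hX' using 1
  funext f
  by_cases hfe : f = e
  · subst hfe; simp [hX'e]
  rw [Function.update_of_ne hfe]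
  refine (hXX' f).elim (fun hXf => ?_) id
  have hfg : f ≠ g := by
    rintro rfl
    simp [hX.2.1] at hXf
  rw [hXf, (hX'0 f).2 ⟨hXf, hC.eq_zero f hfg hfe⟩]

lemma update_zero_mem_boundedComplex (hC : N.IsApex g e C) (hg : N.Transversal {g}ᶜ)
    (hX : X ∈ N.boundedComplex g) (hXe : X e ≠ 0) (hXC : X ≠ C) :
    Function.update X e 0 ∈ N.boundedComplex g := by
  have hXg : X g = 1 := hX.2.1
  have hXe_eq : X e = C e := (hC.apply_eq_zero_or hg hX).resolve_left hXe
  obtain ⟨W, hW, hWe, hWf, -⟩ := exists_elim_signFaceOn (A := {e, g}ᶜ) (X := X) hX.1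
    (N.neg_mem C hC.mem_covectors) (e := e) ⟨hXe, by simp [hXe_eq]⟩ (fun _ _ => Or.inr rfl)
    fun f hf => by
      rw [Set.mem_compl_iff, Set.mem_insert_iff, Set.mem_singleton_iff, not_or] at hf
      exact Or.inl (by simp [hC.eq_zero f hf.2 hf.1])
  have hWX : ∀ f ≠ g, f ≠ e → W f = X f := fun f hfg hfe => by
    rw [hWf f (by simp [hfe, hfg])]
    by_cases hXf : X f = 0 <;> simp [signComp, hXf, hC.eq_zero f hfg hfe]
  rcases ((mem_boundedComplex_iff_signFaceOn hg).1 hX).2.2 W hW fun f hfg => by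
      by_cases hfe : f = e
      · exact Or.inl (hfe ▸ hWe)
      · exact Or.inr (hWX f hfg hfe) with hW0 | hWg
  · refine absurd (funext fun f => ?_) hXC
    by_cases hfg : f = g
    · rw [hfg, hXg, hC.apply_eq_one]
    by_cases hfe : f = e
    · rw [hfe, hXe_eq]
    · rw [← hWX f hfg hfe, hW0, hC.eq_zero f hfg hfe, Pi.zero_apply]
  · have hW_eq : W = Function.update X e 0 := funext fun f => by
      by_cases hfe : f = e
      · subst hfe; simp [hWe]
      by_cases hfg : f = g
      · subst hfg; simp [hfe, hWg, hXg]
      · rw [hWX f hfg hfe, Function.update_of_ne hfe]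
    refine hW_eq ▸ mem_boundedComplex_of_signFace hX hW (hW_eq ▸ fun f => ?_) fun h => ?_
    · by_cases hfe : f = e <;> simp [hfe]
    · simp [h] at hWg

omit [DecidableEq α] in
-- The pyramid is a union of the pairs of a covector that vanishes at `e` and its join with `C`,
-- which cancel, and the single covector `C`.
lemma boundedSum_eq [Finite α] (hC : N.IsApex g e C) (hg : N.IsGenericElement g)
    (hε : N.IsRankSign ε) : N.boundedSum g ε = ε {f | C f = 0} := by
  classical
  have := Fintype.ofFinite α
  have hgt := hg.transversal_compl
  rw [boundedSum_eq_sum_indicator, sum_eq_sum_sum_update (R := ℤ) e 0,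
    Finset.sum_eq_single (Function.update C e 0)]
  · simp only [Function.update_idem]
    rw [Finset.sum_eq_single (C e), Function.update_eq_self,
      Set.indicator_of_mem (hC.mem_boundedComplex hg)]
    · refine fun s _ hs => Set.indicator_of_notMem (fun h => ?_) _
      obtain rfl : s = 0 := by simpa [hs] using hC.apply_eq_zero_or hgt h
      have h0 := hgt _ h.1 fun f (hf : f ≠ g) => by
        by_cases hfe : f = e
        · simp [hfe]
        · simp [hfe, hC.eq_zero f hf hfe]
      simpa [h0] using h.2.1
    · simp
  · intro Y hY hYC
    have hYe : Y e = 0 := by simpa using hY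
    by_cases hex : ∃ s, Function.update Y e s ∈ N.boundedComplex g
    · obtain ⟨s, hs⟩ := hex
      have h0 : Function.update Y e 0 ∈ N.boundedComplex g := by
        by_cases hs0 : s = 0
        · exact hs0 ▸ hs
        · simpa using hC.update_zero_mem_boundedComplex hgt hs (by simpa using hs0) (by
            rintro rfl
            simp [← hYe] at hYC)
      refine hε.sum_indicator_boundedComplex_eq_zero hC.apply_ne_zero fun s =>
        ⟨fun h => by simpa using hC.apply_eq_zero_or hgt h, ?_⟩
      rintro (rfl | rfl)
      · exact h0
      · simpa using hC.update_mem_boundedComplex hg h0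
    · exact Finset.sum_eq_zero fun s _ => Set.indicator_of_notMem (not_exists.1 hex s) _
  · simp

end IsApex

lemma IsApex.rankSign_zeroSet {C : α → SignType} (hC : N.IsApex g e C)
    (hε : N.IsRankSign ε) : ε {f | C f = 0} = -ε {g}ᶜ := by
  have hinsert : insert e {f | C f = 0} = {g}ᶜ := by
    ext f
    by_cases hfe : f = e
    · simp [hfe, hC.ne]
    · by_cases hfg : f = g
      · simp [hfg, hC.ne.symm, hC.apply_eq_one]
      · simp [hfg, hC.eq_zero f hfg hfe]
  have hspan : ¬ N.Spans {f | C f = 0} e :=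
    not_spans_iff.2 ⟨C, hC.mem_covectors, fun _ ha => ha, hC.apply_ne_zero⟩
  rw [← hinsert, hε.insert_eq_neg hspan, neg_neg]

lemma ncard_not_spans_empty_delete_lt [Finite α] [DecidableEq α] (he : ¬ N.Spans ∅ e) :
    {f | ¬ (N.delete e).Spans ∅ f}.ncard < {f | ¬ N.Spans ∅ f}.ncard := by
  refine Set.ncard_lt_ncard (Set.ssubset_iff_of_subset (fun f hf => ?_) |>.2
    ⟨e, he, not_not_intro spans_delete_self⟩) (Set.toFinite _)
  have hfe : f ≠ e := fun h => hf (h ▸ spans_delete_self)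
  simpa [spans_delete_iff hfe] using hf

lemma IsGenericElement.exists_ne_not_spans_empty (hg : N.IsGenericElement g) :
    ∃ e ≠ g, ¬ N.Spans ∅ e := by
  by_contra! h
  exact hg.not_isLoop fun X hX _ => congrFun (hg.transversal_compl X hX fun f hf =>
    spans_empty_iff.1 (h f hf) X hX) g

lemma IsGenericElement.boundedSum_eq [Finite α] (hg : N.IsGenericElement g)
    (hε : N.IsRankSign ε) : N.boundedSum g ε = -ε {g}ᶜ := by
  classical
  induction hn : {f | ¬ N.Spans ∅ f}.ncard using Nat.strong_induction_on generalizing N ε with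
  | _ n ih =>
    obtain ⟨e, heg, he⟩ := hg.exists_ne_not_spans_empty
    by_cases hT : N.Transversal ({g}ᶜ \ {e})
    · have hTe : N.Transversal {e}ᶜ := fun X hX h => hT X hX fun a ha => h a ha.2
      have hε_compl : ε ({g}ᶜ \ {e}) = ε {g}ᶜ := by
        rw [← hε.insert_eq fun X hX h => congrFun (hT X hX h) e, Set.insert_sdiff_singleton,
          Set.insert_eq_of_mem heg]
      rw [← boundedSum_delete hε heg hTe, ← hε_compl]
      exact ih _ (hn ▸ ncard_not_spans_empty_delete_lt he) (hg.delete heg hT) (hε.delete e) rfl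
    · obtain ⟨C, hC⟩ := hg.exists_isApex heg hT
      rw [hC.boundedSum_eq hg hε, hC.rankSign_zeroSet hε]

lemma IsGenericElement.finsum_boundedComplex_vanishing [Finite α] {F : Set α}
    (hg : N.IsGenericElement g) (hε : N.IsRankSign ε) (hgF : g ∉ F) (hF : ¬ N.Transversal F) :
    ∑ᶠ X ∈ {X ∈ N.boundedComplex g | ∀ e ∈ F, X e = 0}, ε {e | X e = 0} = -ε {g}ᶜ := by
  have hcompl : {g}ᶜ ∪ F = {g}ᶜ := Set.union_eq_left.2 (Set.subset_compl_singleton_iff.2 hgF)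
  rw [← hcompl, ← (hg.contract hgF hF).boundedSum_eq (hε.contract F), boundedSum]
  refine finsum_mem_congr (Set.ext fun X => mem_boundedComplex_contract.symm) fun X hX => ?_
  have hFX : F ⊆ {e | X e = 0} := (mem_boundedComplex_contract.1 hX).2
  rw [Set.union_eq_left.2 hFX]

end OrientedMatroid

lemma sum_fiber_eq_mu_mul {ι P R : Type*} [Ring R] [PartialOrder P] [LocallyFiniteOrder P]
    [DecidableEq P] [DecidableLE P] {t : P} (ht : IsTop t) {s : Finset ι} {z : ι → P} {w : ι → R}
    {c : R} (hz : ∀ i ∈ s, z i ≠ t) (h : ∀ x ≠ t, ∑ i ∈ s with x ≤ z i, w i = -c) {x : P}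
    (hx : x ≠ t) : ∑ i ∈ s with z i = x, w i = IncidenceAlgebra.mu R x t * c := by
  let _ : OrderTop P := { top := t, le_top := ht }
  have hsum : ∀ y, (if y = t then c else 0) =
      ∑ v ∈ Finset.Ici y, ((if v = t then c else 0) + ∑ i ∈ s with z i = v, w i) := fun y => by
    have hfiber : ∑ v ∈ Finset.Ici y, ∑ i ∈ s with z i = v, w i = ∑ i ∈ s with y ≤ z i, w i := by
      rw [Finset.sum_fiberwise_eq_sum_filter]
      simp only [Finset.mem_Ici]
    rw [Finset.sum_add_distrib, Finset.sum_ite_eq', if_pos (Finset.mem_Ici.2 (ht y)), hfiber]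
    split_ifs with hy
    · rw [Finset.filter_false_of_mem fun i hi hyz => hz i hi ((ht _).antisymm (hy ▸ hyz)),
        Finset.sum_empty, add_zero]
    · rw [h y hy, add_neg_cancel]
  simpa [hx, ht x] using IncidenceAlgebra.moebius_inversion_top (𝕜 := R) _ _ hsum x

namespace OrientedMatroid

lemma injOn_restrict_boundedTopes {E : Type*} (N : OrientedMatroid (Option E)) :
    Set.InjOn (fun X e => X (some e)) (N.boundedTopes none) := by
  intro X hX Y hY h
  funext e
  cases e with
  | none => rw [hX.1.2.1, hY.1.2.1]
  | some e => exact congrFun h e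

variable {E : Type*} [Finite E] {M : OrientedMatroid E} {N : OrientedMatroid (Option E)}

lemma isRankSign_eRk (M : OrientedMatroid E) :
    M.IsRankSign fun A => (-1) ^ (M.matroid.eRk A).toNat where
  insert_eq {A e} h := by
    rw [← M.matroid.eRk_closure_eq (insert e A),
      Matroid.closure_insert_eq_of_mem_closure ((M.mem_closure_matroid_iff A e).2 h),
      Matroid.eRk_closure_eq]
  insert_eq_neg {A e} h := by
    rw [Matroid.eRk_insert_eq_add_one ⟨Set.mem_univ e, mt (M.mem_closure_matroid_iff A e).1 h⟩,
      ENat.toNat_add (Matroid.isRkFinite_set _ _).eRk_lt_top.ne ENat.one_ne_top, ENat.toNat_one,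
      pow_succ, mul_neg_one]

/-- The flat of `M` on which a covector of a one-element extension of `M` vanishes. The closure
only serves to make this defined for all sign vectors, see `IsGenericExtension.coe_zeroFlat`. -/
def zeroFlat (M : OrientedMatroid E) (X : Option E → SignType) :
    {F : Set E // M.matroid.IsFlat F} :=
  ⟨M.matroid.closure {e | X (some e) = 0}, M.matroid.isFlat_closure _⟩

namespace IsGenericExtension

variable {X : Option E → SignType}

lemma restrict_mem (hN : M.IsGenericExtension N) (hX : X ∈ N.covectors) :
    (fun e => X (some e)) ∈ M.covectors :=
  hN.deletion ▸ Set.mem_image_of_mem _ hX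

lemma exists_lift (hN : M.IsGenericExtension N) {Y : E → SignType} (hY : Y ∈ M.covectors) :
    ∃ X ∈ N.covectors, ∀ e, X (some e) = Y e := by
  rw [hN.deletion] at hY
  obtain ⟨X, hX, rfl⟩ := hY
  exact ⟨X, hX, fun _ => rfl⟩

lemma spans_image_some_iff (hN : M.IsGenericExtension N) {A : Set E} {e : E} :
    N.Spans (some '' A) (some e) ↔ M.Spans A e := by
  simp only [Spans, hN.deletion, Set.forall_mem_image]

lemma transversal_of_spans_image_some (hN : M.IsGenericExtension N) {A : Set E}
    (h : N.Spans (some '' A) none) : N.Transversal (some '' A) := by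
  have hrank : M.matroid.eRank ≤ M.matroid.eRk A := by
    by_contra! hlt
    exact hN.generic A hlt ((N.mem_closure_matroid_iff _ none).2 h)
  have hspanning := (Matroid.spanning_iff_eRk_le (M := M.matroid) (Set.subset_univ A)).2 hrank
  rintro X hX hXA
  funext e
  cases e with
  | none => exact h X hX hXA
  | some e =>
    have he : e ∈ M.matroid.closure A := hspanning.closure_eq ▸ Set.mem_univ e
    exact hN.spans_image_some_iff.2 ((M.mem_closure_matroid_iff A e).1 he) X hX hXA

lemma isGenericElement (hN : M.IsGenericExtension N) : N.IsGenericElement none where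
  not_isLoop h := hN.not_isLoop ((N.mem_closure_matroid_iff ∅ none).2 h)
  not_isColoop := by
    refine fun X hX h => (N.mem_closure_matroid_iff (N.matroid.E \ {none}) none).1 ?_ X hX
      fun a ha => h a ha.2
    by_contra hcl
    exact hN.not_isColoop ((Matroid.isColoop_iff_notMem_closure_compl (Set.mem_univ none)).2 hcl)
  transversal_of_spans A hA h := by
    obtain ⟨A, rfl⟩ : A ∈ Set.range (Set.image some) := by
      rw [Set.mem_range]
      refine ⟨some ⁻¹' A, Set.image_preimage_eq_of_subset fun a ha => ?_⟩
      exact Option.ne_none_iff_exists.1 fun h => hA (h ▸ ha)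
    exact hN.transversal_of_spans_image_some h

lemma mem_boundedTopes_iff (hN : M.IsGenericExtension N) : X ∈ N.boundedTopes none ↔
    X ∈ N.boundedComplex none ∧ ∀ e, X (some e) = 0 → M.Spans ∅ e := by
  rw [hN.isGenericElement.mem_boundedTopes_iff]
  refine and_congr_right fun hX => ?_
  have hX_none : X none = 1 := hX.2.1
  simp [Option.forall, hX_none, ← hN.spans_image_some_iff]

lemma isTope_of_mem_boundedTopesDelete (hN : M.IsGenericExtension N) {T : E → SignType}
    (hT : T ∈ N.boundedTopesDelete) : M.IsTope T := by
  obtain ⟨X, hX, rfl⟩ := hT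
  obtain ⟨hX, h0⟩ := hN.mem_boundedTopes_iff.1 hX
  exact isTope_of_spans_empty (hN.restrict_mem hX.1) h0

lemma coe_zeroFlat (hN : M.IsGenericExtension N) (hX : X ∈ N.covectors) :
    (M.zeroFlat X : Set E) = {e | X (some e) = 0} :=
  ((M.isFlat_matroid_iff _).2 ⟨_, hN.restrict_mem hX, rfl⟩).closure

lemma zeroFlat_eq_closure_empty_iff (hN : M.IsGenericExtension N) (hX : X ∈ N.covectors) :
    M.zeroFlat X = ⟨M.matroid.closure ∅, M.matroid.isFlat_closure ∅⟩ ↔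
      ∀ e, X (some e) = 0 → M.Spans ∅ e := by
  rw [Subtype.ext_iff, hN.coe_zeroFlat hX]
  refine ⟨fun h e he => (M.mem_closure_matroid_iff ∅ e).1 (h.subset he), fun h => ?_⟩
  refine Set.Subset.antisymm (fun e he => (M.mem_closure_matroid_iff ∅ e).2 (h e he)) fun e he => ?_
  exact spans_empty_iff.1 ((M.mem_closure_matroid_iff ∅ e).1 he) _ (hN.restrict_mem hX)

lemma zeroFlat_ne_ground (hN : M.IsGenericExtension N) (hX : X ∈ N.boundedComplex none) :
    M.zeroFlat X ≠ ⟨M.matroid.E, M.matroid.ground_isFlat⟩ := by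
  intro h
  have hzero : ∀ e, X (some e) = 0 := fun e => by
    have he : e ∈ (M.zeroFlat X : Set E) := h ▸ Set.mem_univ e
    rwa [hN.coe_zeroFlat hX.1] at he
  have hX0 : X = 0 := hN.isGenericElement.transversal_compl X hX.1 <| by
    simpa [Option.forall] using hzero
  simpa [hX0] using hX.2.1

lemma closure_empty_ne_ground (hN : M.IsGenericExtension N) :
    M.matroid.closure ∅ ≠ M.matroid.E := by
  intro h
  obtain ⟨e, he, hloop⟩ := hN.isGenericElement.exists_ne_not_spans_empty
  obtain ⟨e, rfl⟩ := Option.ne_none_iff_exists'.1 he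
  have he : e ∈ M.matroid.closure ∅ := h ▸ Set.mem_univ e
  refine hloop ?_
  simpa using hN.spans_image_some_iff.2 ((M.mem_closure_matroid_iff ∅ e).1 he)

lemma not_transversal_image_some (hN : M.IsGenericExtension N) {F : Set E}
    (hF : M.matroid.IsFlat F) (hFE : F ≠ M.matroid.E) : ¬ N.Transversal (some '' F) := by
  refine fun h => hFE (Set.eq_univ_of_forall fun e => ?_)
  rw [← hF.closure, mem_closure_matroid_iff]
  exact hN.spans_image_some_iff.1 fun X hX hXF => congrFun (h X hX hXF) _

open Classical in
lemma sum_le_zeroFlat (hN : M.IsGenericExtension N) {ε : Set (Option E) → ℤ}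
    (hε : N.IsRankSign ε) {F : {F : Set E // M.matroid.IsFlat F}}
    (hF : F ≠ ⟨M.matroid.E, M.matroid.ground_isFlat⟩) :
    ∑ X ∈ (Set.toFinite (N.boundedComplex none)).toFinset with F ≤ M.zeroFlat X,
      ε {e | X e = 0} = -ε {none}ᶜ := by
  rw [← hN.isGenericElement.finsum_boundedComplex_vanishing hε (F := some '' F.1) (by simp)
    (hN.not_transversal_image_some F.2 fun h => hF (Subtype.ext h)), ← finsum_mem_coe_finset]
  refine finsum_mem_congr (Set.ext fun X => ?_) fun _ _ => rfl
  rw [Finset.mem_coe, Finset.mem_filter, Set.Finite.mem_toFinset, Set.mem_ofPred_eq,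
    Set.forall_mem_image]
  refine and_congr_right fun hX => ?_
  rw [← Subtype.coe_le_coe, hN.coe_zeroFlat hX.1]
  rfl

open Classical in
lemma sum_zeroFlat_eq_closure_empty (hN : M.IsGenericExtension N) (ε : Set (Option E) → ℤ) :
    ∑ X ∈ (Set.toFinite (N.boundedComplex none)).toFinset with
      M.zeroFlat X = ⟨M.matroid.closure ∅, M.matroid.isFlat_closure ∅⟩, ε {e | X e = 0} =
    N.boundedTopesDelete.ncard * ε (some '' M.matroid.closure ∅) := by
  have hzeroSet : ∀ X ∈ N.boundedComplex none,
      M.zeroFlat X = ⟨M.matroid.closure ∅, M.matroid.isFlat_closure ∅⟩ →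
      {e | X e = 0} = some '' M.matroid.closure ∅ := fun X hX h => by
    have hX_none : X none = 1 := hX.2.1
    have hF : {e | X (some e) = 0} = M.matroid.closure ∅ :=
      (hN.coe_zeroFlat hX.1).symm.trans (congrArg Subtype.val h)
    rw [← hF]
    ext (_ | e) <;> simp [hX_none]
  rw [Finset.sum_congr rfl fun X hX => ?_, Finset.sum_const, nsmul_eq_mul, boundedTopesDelete,
    N.injOn_restrict_boundedTopes.ncard_image, ← Set.ncard_coe_finset]
  · congr 3
    ext X
    rw [Finset.mem_coe, Finset.mem_filter, Set.Finite.mem_toFinset, hN.mem_boundedTopes_iff]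
    exact and_congr_right fun hX => hN.zeroFlat_eq_closure_empty_iff hX.1
  · rw [Finset.mem_filter, Set.Finite.mem_toFinset] at hX
    rw [hzeroSet X hX.1 hX.2]

theorem ncard_boundedTopesDelete {E : Type*} [Fintype E] {M : OrientedMatroid E}
    {N : OrientedMatroid (Option E)} (hN : M.IsGenericExtension N) :
    N.boundedTopesDelete.ncard = M.matroid.mobiusNumber.natAbs := by
  classical
  let _ : LocallyFiniteOrder {F : Set E // M.matroid.IsFlat F} := Fintype.toLocallyFiniteOrder
  let ε : Set (Option E) → ℤ := fun A => (-1) ^ (N.matroid.eRk A).toNat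
  have hε : N.IsRankSign ε := N.isRankSign_eRk
  have hε_natAbs : ∀ A, (ε A).natAbs = 1 := fun A => by simp [ε, Int.natAbs_pow]
  have hsum := sum_fiber_eq_mu_mul (t := ⟨M.matroid.E, M.matroid.ground_isFlat⟩)
    (fun F => F.2.subset_ground) (s := (Set.toFinite (N.boundedComplex none)).toFinset)
    (fun X hX => hN.zeroFlat_ne_ground ((Set.Finite.mem_toFinset _).1 hX))
    (fun F hF => hN.sum_le_zeroFlat hε hF)
    (x := ⟨M.matroid.closure ∅, M.matroid.isFlat_closure ∅⟩)
    (mt (congrArg Subtype.val) hN.closure_empty_ne_ground)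
  rw [hN.sum_zeroFlat_eq_closure_empty] at hsum
  have hcard := congrArg Int.natAbs hsum
  rwa [Int.natAbs_mul, Int.natAbs_mul, hε_natAbs, hε_natAbs, mul_one, mul_one,
    Int.natAbs_natCast] at hcard

end IsGenericExtension

end OrientedMatroid

section MinWeightBase

variable {E : Type*} [Fintype E] {U : Matroid E} {ω : E → ℝ} {B : Set E} {e : E}

lemma setWeight_insert (he : e ∉ B) : setWeight ω (insert e B) = ω e + setWeight ω B := by
  simp only [setWeight, ← finsum_mem_eq_toFinset_sum]
  exact finsum_mem_insert ω he B.toFinite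

lemma setWeight_insert_sdiff_singleton {f : E} (he : e ∈ B) (hf : f ∉ B) :
    setWeight ω (insert f (B \ {e})) = setWeight ω B - ω e + ω f := by
  have hB : setWeight ω B = ω e + setWeight ω (B \ {e}) := by
    rw [← setWeight_insert (by simp), Set.insert_sdiff_self_of_mem he]
  rw [setWeight_insert fun h => hf h.1, hB]
  ring

lemma exists_isMinWeightBase (U : Matroid E) (ω : E → ℝ) : ∃ B, U.IsMinWeightBase ω B := by
  obtain ⟨B, hB, hmin⟩ := (Set.toFinite {B | U.IsBase B}).exists_minimalFor (setWeight ω) _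
    U.exists_isBase
  exact ⟨B, hB, fun C hC => (le_total _ _).elim id (hmin hC)⟩

lemma notMem_closure_of_isMinWeightBase (hB : U.IsMinWeightBase ω B) (he : e ∈ B) :
    e ∉ U.closure {f | ω f < ω e} := by
  intro hcl
  have heB : e ∉ U.closure (B \ {e}) := hB.1.indep.notMem_closure_sdiff_of_mem he
  obtain ⟨f, hfE, hfe, hf⟩ : ∃ f ∈ U.E, ω f < ω e ∧ f ∉ U.closure (B \ {e}) := by
    by_contra! h
    rw [← U.closure_inter_ground] at hcl
    exact heB (U.closure_subset_closure_of_subset_closure (fun f hf => h f hf.2 hf.1) hcl)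
  have hfB : f ∉ B := fun hfB => hf (U.mem_closure_of_mem' ⟨hfB, ne_of_apply_ne ω hfe.ne⟩)
  have hle := hB.2 _ (hB.1.exchange_base_of_notMem_closure he hf)
  rw [setWeight_insert_sdiff_singleton he hfB] at hle
  linarith

lemma exists_isMinWeightBase_mem (heE : e ∈ U.E) (he : e ∉ U.closure {f | ω f < ω e}) :
    ∃ B, U.IsMinWeightBase ω B ∧ e ∈ B := by
  obtain ⟨B, hB, hmin⟩ := exists_isMinWeightBase U ω
  by_cases heB : e ∈ B
  · exact ⟨B, ⟨hB, hmin⟩, heB⟩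
  have hI : U.Indep (insert e (B ∩ {f | ω f < ω e})) := by
    rw [(hB.indep.inter_right _).insert_indep_iff]
    exact Or.inl ⟨heE, fun h => he (U.closure_subset_closure Set.inter_subset_right h)⟩
  obtain ⟨C, hC, hIC, hCI⟩ := hI.exists_isBase_subset_union_isBase hB
  have heC : e ∈ C := hIC (Set.mem_insert e _)
  obtain ⟨f, hfB, hfC⟩ : ∃ f ∈ B, f ∉ C := by
    by_contra! h
    exact heB (hB.eq_of_subset_isBase hC h ▸ heC)
  obtain ⟨y, ⟨hyC, hyB⟩, hbase⟩ := hB.exchange_mem hC hfB hfC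
  obtain rfl : y = e := by
    rcases hCI hyC with (h | h) | h
    · exact h
    · exact absurd h.1 hyB
    · exact absurd h hyB
  have hyf : ω y ≤ ω f := not_lt.1 fun h => hfC (hIC (Set.mem_insert_of_mem _ ⟨hfB, h⟩))
  refine ⟨_, ⟨hbase, fun D hD => ?_⟩, Set.mem_insert y _⟩
  rw [setWeight_insert_sdiff_singleton hfB hyB]
  linarith [hmin D hD]

end MinWeightBase

namespace OrientedMatroid

section Bergman

variable {E : Type*} [Fintype E] {M : OrientedMatroid E} {ω : E → ℝ}

lemma mem_bergman_iff : ω ∈ M.matroid.bergman ↔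
    ω ∈ weightSphere E ∧ ∀ e, ¬ M.Spans {f | ω f < ω e} e := by
  refine and_congr_right fun _ => forall_congr' fun e => ?_
  have hspans := M.mem_closure_matroid_iff {f | ω f < ω e} e
  exact ⟨fun ⟨B, hB, he⟩ h => notMem_closure_of_isMinWeightBase hB he (hspans.2 h),
    fun h => exists_isMinWeightBase_mem (Set.mem_univ e) (mt hspans.1 h)⟩

lemma exists_eq_zero_iff_lt_of_mem_bergman (hω : ω ∈ M.matroid.bergman) (c : ℝ) :
    ∃ X ∈ M.covectors, ∀ e, X e = 0 ↔ ω e < c := by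
  have hflat : M.matroid.IsFlat {e | ω e < c} := by
    rw [Matroid.isFlat_iff_closure_eq]
    refine Set.Subset.antisymm (fun e he => ?_) (M.matroid.subset_closure _ (Set.subset_univ _))
    by_contra hce
    exact (mem_bergman_iff.1 hω).2 e fun X hX h =>
      (M.mem_closure_matroid_iff _ e).1 he X hX fun f (hf : ω f < c) =>
        h f (hf.trans_le (not_lt.1 hce))
  obtain ⟨X, hX, hXc⟩ := (M.isFlat_matroid_iff _).1 hflat
  exact ⟨X, hX, fun e => (Set.ext_iff.1 hXc e).symm⟩

lemma positiveBergman_reorient_subset_bergman (A : Set E) :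
    (M.reorient A).positiveBergman ⊆ M.matroid.bergman := by
  rintro ω ⟨hω, hacyclic⟩
  refine mem_bergman_iff.2 ⟨hω, fun e => not_spans_iff.2 ?_⟩
  obtain ⟨X, hX, hX0, hX1⟩ := hacyclic (ω e)
  refine ⟨_, hX, fun f hf => by simp [signFlip, hX0 f hf], ?_⟩
  simp only [signFlip, ← hX1 e rfl]
  split_ifs <;> decide

lemma mem_positiveBergman_reorient {T : E → SignType} (hT : ∀ e, T e ≠ 0)
    (hω : ω ∈ weightSphere E) (h : ∀ e, ∃ X ∈ M.covectors, (∀ f, ω f < ω e → X f = 0) ∧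
      ∀ f, ω f = ω e → X f = T f) :
    ω ∈ (M.reorient {e | T e = -1}).positiveBergman := by
  have hflip : ∀ e, signFlip {e | T e = -1} T e = 1 := fun e => by
    rcases signType_eq_or_eq_neg (hT e) one_ne_zero with h | h <;> simp [signFlip, h]
  refine ⟨hω, fun c => ?_⟩
  by_cases hc : ∃ e, ω e = c
  · obtain ⟨e, rfl⟩ := hc
    obtain ⟨X, hX, hX0, hXT⟩ := h e
    have hX_mem : signFlip {e | T e = -1} X ∈ (M.reorient {e | T e = -1}).covectors := by
      rwa [reorient, Set.mem_ofPred_eq, signFlip_signFlip]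
    refine ⟨_, hX_mem, fun f hf => by simp [signFlip, hX0 f hf], fun f hf => ?_⟩
    refine (hflip f).symm.trans ?_
    simp [signFlip, hXT f hf]
  · exact ⟨0, (M.reorient _).zero_mem, fun _ _ => rfl, fun e he => absurd ⟨e, he⟩ hc⟩

end Bergman

namespace IsGenericExtension

variable {E : Type*} [Fintype E] {M : OrientedMatroid E} {N : OrientedMatroid (Option E)}

lemma exists_boundedComplex_of_mem_bergman (hN : M.IsGenericExtension N) {ω : E → ℝ}
    (hω : ω ∈ M.matroid.bergman) :
    ∃ T ∈ N.boundedComplex none, ∀ e, ∃ X ∈ N.covectors, SignFace X T ∧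
      ∀ f, X (some f) = 0 ↔ ω f < ω e := by
  classical
  have hsublevel : ∀ c, ∃ P ∈ N.covectors, ∀ e, P (some e) = 0 ↔ ω e < c := fun c => by
    obtain ⟨Y, hY, hYc⟩ := exists_eq_zero_iff_lt_of_mem_bergman hω c
    obtain ⟨P, hP, hPY⟩ := hN.exists_lift hY
    exact ⟨P, hP, fun e => by rw [hPY, hYc]⟩
  choose P hP hP_zero using hsublevel
  have : Nonempty E := by
    by_contra hE
    rw [not_nonempty_iff] at hE
    simpa using hω.1.2
  obtain ⟨e₀, he₀⟩ := Finite.exists_max ω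
  have hP_ne : P (ω e₀) ≠ 0 := fun h =>
    lt_irrefl (ω e₀) ((hP_zero (ω e₀) e₀).1 (congrFun h _))
  have hP_mono : ∀ c d, c ≤ d → ∀ f ≠ none, P c f = 0 → P d f = 0 := by
    rintro c d hcd (_ | f) hf h
    · exact absurd rfl hf
    · exact (hP_zero d f).2 (((hP_zero c f).1 h).trans_le hcd)
  obtain ⟨T, hT, -, hTX⟩ := hN.isGenericElement.exists_boundedComplex_of_chain hP hP_mono
    (hP (ω e₀)) hP_ne (Finset.univ.image ω) (by simpa using fun e => hP_mono _ _ (he₀ e))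
  refine ⟨T, hT, fun e => ?_⟩
  obtain ⟨X, hX, hXT, hX_zero⟩ := hTX (ω e) (by simp)
  exact ⟨X, hX, hXT, fun f => (hX_zero _ (by simp)).trans (hP_zero _ f)⟩

lemma bergman_subset_iUnion_positiveBergman (hN : M.IsGenericExtension N) : M.matroid.bergman ⊆
    ⋃ T ∈ N.boundedTopesDelete, (M.reorient {e | T e = -1}).positiveBergman := by
  intro ω hω
  obtain ⟨T, hT, hface⟩ := hN.exists_boundedComplex_of_mem_bergman hω
  have hT_ne : ∀ e, T (some e) ≠ 0 := fun e he => by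
    obtain ⟨X, -, hXT, hX⟩ := hface e
    exact lt_irrefl _ ((hX e).1 (hXT.eq_zero he))
  refine Set.mem_biUnion ⟨T, hN.mem_boundedTopes_iff.2 ⟨hT, fun e he => absurd he (hT_ne e)⟩, rfl⟩
    (mem_positiveBergman_reorient hT_ne hω.1 fun e => ?_)
  obtain ⟨X, hX, hXT, hX_zero⟩ := hface e
  refine ⟨_, hN.restrict_mem hX, fun f => (hX_zero f).2, fun f hf => ?_⟩
  exact (hXT _).resolve_left fun h => ((hX_zero f).1 h).ne hf

lemma iUnion_positiveBergman (hN : M.IsGenericExtension N) :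
    (⋃ T ∈ N.boundedTopesDelete, (M.reorient {e | T e = -1}).positiveBergman) =
      M.matroid.bergman :=
  Set.Subset.antisymm (Set.iUnion₂_subset fun _ _ => positiveBergman_reorient_subset_bergman _)
    hN.bergman_subset_iUnion_positiveBergman

end IsGenericExtension

end OrientedMatroid

theorem mainTheorem3 {E : Type*} [Fintype E] (M : OrientedMatroid E)
    (N : OrientedMatroid (Option E)) (hN : M.IsGenericExtension N) :
    (∀ T ∈ N.boundedTopesDelete, M.IsTope T) ∧
    N.boundedTopesDelete.ncard = M.matroid.mobiusNumber.natAbs ∧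
    (⋃ T ∈ N.boundedTopesDelete, (M.reorient {e | T e = -1}).positiveBergman) =
      M.matroid.bergman :=
  ⟨fun _ => hN.isTope_of_mem_boundedTopesDelete, hN.ncard_boundedTopesDelete,
    hN.iUnion_positiveBergman⟩
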